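/- **Theorem (Stability: Jump).** Let $I=[0,1]$ with Lebesgue measure, and let $\|O\|=\sqrt{\operatorname{tr}(OO^\dagger)}$ denote the Frobenius norm of a matrix. A graphon is a symmetric measurable function $W:I^2\to[0,1]$; the cut norm of a kernel is $\|W\|_\square=\sup_{B_1,B_2}\big|\int_{B_1\times B_2}W(u,v)\,du\,dv\big|$, the supremum being over Borel sets $B_1,B_2\subseteq I$. Let $T>0$, let $\tilde H\in M_d(\mathbb C)$ be Hermitian, let $L\in M_d(\mathbb C)$ be unitary, and let $A$ be an operator on $\mathbb C^d\otimes\mathbb C^d$ with kernel $a(x,y;x',y')=\overline{a(x',y';x,y)}=a(y,x;y',x')$ and $\|A\|$ its Hilbert–Schmidt norm. For $\rho\in M_d(\mathbb C)$ put $A^{\rho}(x,x')=\sum_{y,y'}a(x,y;x',y')\overline{\rho(y,y')}$. On a filtered probability space let $(N^u)_{u\in I}$ be Poisson processes of intensity one relative to the filtration (no assumption is made on their joint law), and let $\rho_0$ be a density matrix. A solution on $[0,T]$ of the photon-counting graphon system with graphon $W$ is a family of adapted, almost surely càdlàg $M_d(\mathbb C)$-valued processes $(\gamma^u)_{u\in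 I}$, such that $\gamma_{s-}^v$ is integrable for all $v\in I$, $s\in(0,T]$, $(s,v)\mapsto\mathbb E[\gamma_{s-}^v]$ is integrable on $[0,T]\times I$, and, for every $u\in I$, $\gamma_0^u=\rho_0$ and $$d\gamma_t^u=-\mathrm i\Big[\tilde H+\int_0^1W(u,v)A^{\mathbb E[\gamma_{t-}^v]}\,dv,\ \gamma_{t-}^u\Big]dt+\big(L\gamma_{t-}^uL^\dagger-\gamma_{t-}^u\big)\,dN_t^u .$$ Then there is a constant $C=C(T,\|\tilde H\|,\|A\|,\|L\|)$, depending on nothing else, such that, whenever $\tilde\gamma$ and $\hat\gamma$ are solutions on $[0,T]$ with graphons $\tilde W$ and $\hat W$, with the same initial condition $\rho_0$ and driven by the same processes $(N^u)_{u\in I}$: 1. if $(\omega,u)\mapsto\sup_{t\in[0,T]}\|\tilde\gamma_t^u(\omega)-\hat\gamma_t^u(\omega)\|^2$ is measurable with respect to the completed product $\sigma$-algebra, then $$\mathbb E\Big[\int_I\sup_{t\in[0,T]}\|\tilde\gamma_t^u-\hat\gamma_t^u\|^2\,du\Big]\le C\,\|\tilde W-\hat W\|_\square ;$$ 2. without any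 joint measurability assumption, $$\int_I^{*}\mathbb E\Big[\sup_{t\in[0,T]}\|\tilde\gamma_t^u-\hat\gamma_t^u\|^2\Big]du\le C\,\|\tilde W-\hat W\|_\square ,$$ where $\int_I^{*}$ is the upper integral, i.e. the infimum of the integrals of the measurable majorants. -/

import Mathlib

open MeasureTheory ProbabilityTheory Filter Topology Set
open scoped ENNReal NNReal unitInterval ComplexOrder

-- Matrices carry the Frobenius norm `‖O‖ = √(tr (O O†))`.
attribute [local instance] Matrix.frobeniusNormedAddCommGroup

/-- A graphon: a symmetric measurable function `I × I → [0, 1]`, where `I = [0, 1]`. -/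
structure IsGraphon (W : I → I → ℝ) : Prop where
  measurable : Measurable fun p : I × I => W p.1 p.2
  symm : ∀ u v, W u v = W v u
  nonneg : ∀ u v, 0 ≤ W u v
  le_one : ∀ u v, W u v ≤ 1

/-- The cut norm of a kernel: the supremum of `|∫_{B₁ × B₂} W|` over Borel sets `B₁, B₂ ⊆ I`. -/
noncomputable def cutNorm (W : I → I → ℝ) : ℝ :=
  ⨆ B : {S : Set I // MeasurableSet S} × {S : Set I // MeasurableSet S},
    |∫ p in (B.1 : Set I) ×ˢ (B.2 : Set I), W p.1 p.2 ∂(volume.prod volume)|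

/-- Density matrices: positive semidefinite (in particular Hermitian) with trace one. -/
def IsDensityMatrix {d : ℕ} (ρ : Matrix (Fin d) (Fin d) ℂ) : Prop :=
  ρ.PosSemidef ∧ ρ.trace = 1

/-- The kernel `a (x, y; x', y')` of a pair interaction operator on `ℂ^d ⊗ ℂ^d`:
it is self-adjoint and symmetric under the exchange of the two particles.  Its Frobenius norm as
a matrix is the Hilbert-Schmidt norm of the kernel. -/
structure IsPairInteraction {d : ℕ} (a : Matrix (Fin d × Fin d) (Fin d × Fin d) ℂ) : Prop where
  selfAdjoint : a.IsHermitian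
  exchange : ∀ x y x' y', a (x, y) (x', y') = a (y, x) (y', x')

/-- The one-particle operator
`A^ρ (x, x') = ∑_{y, y'} a (x, y; x', y') * conj (ρ (y, y'))`. -/
def partialInteraction {d : ℕ} (a : Matrix (Fin d × Fin d) (Fin d × Fin d) ℂ)
    (ρ : Matrix (Fin d) (Fin d) ℂ) : Matrix (Fin d) (Fin d) ℂ :=
  Matrix.of fun x x' => ∑ y, ∑ y', a (x, y) (x', y') * star (ρ y y')

/-- `N` is a Poisson process of intensity one relative to the filtration `ℱ`: an adapted counting
process (almost surely null at zero, nondecreasing, right-continuous, with jumps of size one)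
whose increment over `[s, t]` is independent of `ℱ s` and Poisson distributed with mean `t - s`.
Only times `t ≥ 0` matter. -/
structure IsUnitPoissonProcess {Ω : Type*} [MeasurableSpace Ω] (P : Measure Ω)
    (ℱ : Filtration ℝ (inferInstance : MeasurableSpace Ω)) (N : ℝ → Ω → ℕ) : Prop where
  adapted : ∀ t, 0 ≤ t → Measurable[ℱ t] (N t)
  zero : ∀ᵐ ω ∂P, N 0 ω = 0
  mono : ∀ᵐ ω ∂P, MonotoneOn (fun t => N t ω) (Ici 0)
  rightCont : ∀ᵐ ω ∂P, ∀ t, 0 ≤ t → ContinuousWithinAt (fun r => N r ω) (Ici t) t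
  unitJumps : ∀ᵐ ω ∂P, ∀ t, 0 < t → N t ω ≤ Function.leftLim (fun r => N r ω) t + 1
  indep : ∀ s t, 0 ≤ s → s ≤ t →
    Indep (MeasurableSpace.comap (fun ω => N t ω - N s ω) ⊤) (ℱ s) P
  law : ∀ s t, 0 ≤ s → s ≤ t →
    P.map (fun ω => N t ω - N s ω) = poissonMeasure (t - s).toNNReal

/-- The path is càdlàg on `[0, T]`. -/
def IsCadlagOn {E : Type*} [TopologicalSpace E] (T : ℝ) (x : ℝ → E) : Prop :=
  (∀ t, 0 ≤ t → t < T → ContinuousWithinAt x (Ici t) t) ∧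
    ∀ t, 0 < t → t ≤ T → ∃ l, Tendsto x (𝓝[<] t) (𝓝 l)

/-- The pathwise integral `∫_{(0, t]} x_s dn_s` of a path `x` against a counting path `n`
(which has finitely many jumps in `(0, t]`): the sum of `(n_s - n_{s-}) x_s` over `0 < s ≤ t`. -/
noncomputable def countingIntegral {E : Type*} [AddCommMonoid E] (n : ℝ → ℕ) (x : ℝ → E)
    (t : ℝ) : E :=
  ∑ᶠ s ∈ Ioc 0 t, (n s - Function.leftLim n s) • x s

/-- The integral of a matrix-valued function, taken entry by entry. -/
noncomputable def matrixIntegral {X : Type*} [MeasurableSpace X] (μ : Measure X) {d : ℕ}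
    (f : X → Matrix (Fin d) (Fin d) ℂ) : Matrix (Fin d) (Fin d) ℂ :=
  Matrix.of fun i j => ∫ x, f x i j ∂μ

/-- Integrability of a matrix-valued function: every entry is integrable. -/
def MatrixIntegrable {X : Type*} [MeasurableSpace X] (μ : Measure X) {d : ℕ}
    (f : X → Matrix (Fin d) (Fin d) ℂ) : Prop :=
  ∀ i j, Integrable (fun x => f x i j) μ

/-- The mean `E[γ_{s-}^v]` of the left limits. -/
noncomputable def leftMean {Ω : Type*} [MeasurableSpace Ω] (P : Measure Ω) {d : ℕ}
    (γ : I → ℝ → Ω → Matrix (Fin d) (Fin d) ℂ) (s : ℝ) (v : I) : Matrix (Fin d) (Fin d) ℂ :=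
  matrixIntegral P fun ω => Function.leftLim (fun r => γ v r ω) s

/-- The effective Hamiltonian `H + ∫_I W(u, v) A^{E[γ_{s-}^v]} dv` of the particle `u`. -/
noncomputable def effectiveHamiltonian {Ω : Type*} [MeasurableSpace Ω] (P : Measure Ω) {d : ℕ}
    (H : Matrix (Fin d) (Fin d) ℂ) (a : Matrix (Fin d × Fin d) (Fin d × Fin d) ℂ)
    (W : I → I → ℝ) (γ : I → ℝ → Ω → Matrix (Fin d) (Fin d) ℂ) (s : ℝ) (u : I) :
    Matrix (Fin d) (Fin d) ℂ :=
  H + matrixIntegral volume fun v => (W u v : ℂ) • partialInteraction a (leftMean P γ s v)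

/-- `γ` solves on `[0, T]` the photon-counting graphon system with initial state `ρ₀`: for every
`u ∈ I`, almost surely, for all `t ∈ [0, T]`,
`γ_t^u = ρ₀ - i ∫_0^t [H + ∫_I W(u, v) A^{E[γ_{s-}^v]} dv, γ_{s-}^u] ds`
`         + ∫_{(0, t]} (L γ_{s-}^u L† - γ_{s-}^u) dN_s^u`.
The fields `integrable_left` and `integrable_mean` say that the expectations and the `dv ds`
integrals in the equation exist. -/
structure IsJumpGraphonSolution {Ω : Type*} [MeasurableSpace Ω] (P : Measure Ω)
    (ℱ : Filtration ℝ (inferInstance : MeasurableSpace Ω)) (N : I → ℝ → Ω → ℕ) (T : ℝ) {d : ℕ}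
    (H L : Matrix (Fin d) (Fin d) ℂ) (a : Matrix (Fin d × Fin d) (Fin d × Fin d) ℂ)
    (W : I → I → ℝ) (ρ₀ : Matrix (Fin d) (Fin d) ℂ)
    (γ : I → ℝ → Ω → Matrix (Fin d) (Fin d) ℂ) : Prop where
  adapted : ∀ u t, 0 ≤ t → t ≤ T → StronglyMeasurable[ℱ t] (γ u t)
  cadlag : ∀ u, ∀ᵐ ω ∂P, IsCadlagOn T fun t => γ u t ω
  integrable_left : ∀ u s, 0 < s → s ≤ T →
    MatrixIntegrable P fun ω => Function.leftLim (fun r => γ u r ω) s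
  integrable_mean : MatrixIntegrable ((volume.restrict (Ioc 0 T)).prod (volume : Measure I))
    fun p => leftMean P γ p.1 p.2
  equation : ∀ u, ∀ᵐ ω ∂P, ∀ t, 0 ≤ t → t ≤ T →
    γ u t ω = ρ₀
      + matrixIntegral (volume.restrict (Ioc 0 t)) (fun s => (-Complex.I) •
          (effectiveHamiltonian P H a W γ s u * Function.leftLim (fun r => γ u r ω) s
            - Function.leftLim (fun r => γ u r ω) s * effectiveHamiltonian P H a W γ s u))
      + countingIntegral (fun r => N u r ω)
          (fun s => L * Function.leftLim (fun r => γ u r ω) s * L.conjTranspose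
            - Function.leftLim (fun r => γ u r ω) s) t

/-- `sup_{t ∈ [0, T]} ‖x_t - y_t‖²` as an extended nonnegative real. -/
noncomputable def supSqDist {d : ℕ} (T : ℝ) (x y : ℝ → Matrix (Fin d) (Fin d) ℂ) : ℝ≥0∞ :=
  ⨆ t ∈ Icc 0 T, ‖x t - y t‖ₑ ^ 2

/-- The upper integral of a function on `I` that is not assumed to be measurable: the infimum of
the integrals of its measurable majorants. -/
noncomputable def upperIntegral (f : I → ℝ≥0∞) : ℝ≥0∞ :=
  ⨅ g : {g : I → ℝ≥0∞ // Measurable g ∧ ∀ u, f u ≤ g u}, ∫⁻ u, g.1 u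

/-! ### Paths with isometric jumps -/

/-! The stochastic equation can be treated path by path. At a jump of `N^u` the state passes from
`z` to `L z L†`, a linear isometry of the Frobenius norm. Two solutions driven by the same `N^u`
jump at the same times by the same map, so their difference `D` also jumps isometrically: `‖D‖` is
continuous in time and grows only through the drift. Neither martingale estimates nor the joint law
of the `N^u` enter (`IsJumpPath.norm_le_add_integral`, `IsJumpPath.gronwall`).

The drift needs a bound independent of the solution. If the effective Hamiltonian is Hermitian, the
velocity `-i[K, x]` is orthogonal to `x` and the norm is conserved, hence at most one. But a
solution is not assumed Hermitian, and the Hamiltonian is Hermitian only once the means are. This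
circle is broken in three steps: a crude bound, depending on the solution but uniform in `u`, from
Grönwall's inequality with an integrable kernel (`exists_norm_le`); a Grönwall argument for `γ -
γ†`, run for all particles together (`ae_isHermitian`); then conservation of the norm
(`ae_norm_eq`).

With norms at most one, `‖D_t^u‖ ≤ c₀ ∫_0^t ‖K₁ - K₂‖ ds` almost surely, and the right side is
deterministic. The difference `K₁ - K₂` consists of a part due to the means, bounded by `‖a‖ Φ(s)`
with `Φ(s)` the integral over `v` of the distance of the means, and a part `∫ (W₁ - W₂)(u, v)
A^{m(s, v)} dv`. The `L¹` norm in `u` of the latter is bounded by the cut norm, which controls the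
operator norm from `L^∞` to `L^1` (`integral_abs_kernel_le`). Integrating over `u` closes an
inequality for `Φ`, and a last Grönwall step gives a bound linear in the cut norm. Since `‖D‖ ≤ 2`,
also `‖D‖² ≤ 2‖D‖`, so the squared distance obeys a linear bound too.

Everything passes through one deterministic majorant that is measurable in `u`
(`exists_measurable_majorant`). This makes the upper integral statement as accessible as the jointly
measurable one. The dimension introduced by working entrywise is absorbed by `‖L‖² = d`. -/

theorem norm_leftLim_le {E : Type*} [NormedAddCommGroup E] {x : ℝ → E} {w : ℝ → ℝ} {t : ℝ} (ht : 0 < t)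
    (hx : Tendsto x (𝓝[<] t) (𝓝 (Function.leftLim x t))) (hw : ContinuousAt w t)
    (h : ∀ s, 0 ≤ s → s < t → ‖x s‖ ≤ w s) : ‖Function.leftLim x t‖ ≤ w t := by
  refine le_of_tendsto_of_tendsto hx.norm (hw.tendsto.mono_left nhdsWithin_le_nhds) ?_
  filter_upwards [Ioo_mem_nhdsLT ht] with s hs using h s hs.1.le hs.2

section JumpPath

variable {E : Type*} [NormedAddCommGroup E] [NormedSpace ℝ E]

/-- `x` flows with velocity `f` and jumps from `z` to `U z` at the times of `J`. -/
structure IsJumpPath (T : ℝ) (J : Set ℝ) (U : E → E) (x f : ℝ → E) : Prop where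
  tendsto_left : ∀ t, 0 < t → t ≤ T → Tendsto x (𝓝[<] t) (𝓝 (Function.leftLim x t))
  eq_jump : ∀ t ∈ J, 0 < t → t ≤ T → x t = U (Function.leftLim x t)
  eq_leftLim : ∀ t ∉ J, 0 < t → t ≤ T → x t = Function.leftLim x t
  flow : ∀ t, 0 ≤ t → t < T → ∀ᶠ r in 𝓝[>] t, x r = x t + ∫ s in Ioc t r, f s
  integrableOn : IntegrableOn f (Ioc 0 T)

namespace IsJumpPath

variable {T : ℝ} {J : Set ℝ} {U : E → E} {x y f g : ℝ → E}

theorem integrableOn_Ioc (h : IsJumpPath T J U x f) {s t : ℝ} (hs : 0 ≤ s) (ht : t ≤ T) :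
    IntegrableOn f (Ioc s t) :=
  h.integrableOn.mono_set (Ioc_subset_Ioc hs ht)

theorem leftLim_sub (hx : IsJumpPath T J U x f) (hy : IsJumpPath T J U y g) {t : ℝ} (h0 : 0 < t)
    (ht : t ≤ T) :
    Function.leftLim (fun s => x s - y s) t = Function.leftLim x t - Function.leftLim y t :=
  leftLim_eq_of_tendsto ((hx.tendsto_left t h0 ht).sub (hy.tendsto_left t h0 ht))

theorem sub (hx : IsJumpPath T J U x f) (hy : IsJumpPath T J U y g)
    (hU : ∀ a b, U (a - b) = U a - U b) :
    IsJumpPath T J U (fun t => x t - y t) (fun t => f t - g t) where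
  tendsto_left t h0 ht := by
    rw [hx.leftLim_sub hy h0 ht]
    exact (hx.tendsto_left t h0 ht).sub (hy.tendsto_left t h0 ht)
  eq_jump t hJ h0 ht := by
    rw [hx.leftLim_sub hy h0 ht, hU, hx.eq_jump t hJ h0 ht, hy.eq_jump t hJ h0 ht]
  eq_leftLim t hJ h0 ht := by
    rw [hx.leftLim_sub hy h0 ht, hx.eq_leftLim t hJ h0 ht, hy.eq_leftLim t hJ h0 ht]
  flow t h0 ht := by
    filter_upwards [hx.flow t h0 ht, hy.flow t h0 ht, Ioo_mem_nhdsGT ht] with r h1 h2 hr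
    rw [integral_sub (hx.integrableOn_Ioc h0 hr.2.le) (hy.integrableOn_Ioc h0 hr.2.le), h1, h2]
    abel
  integrableOn := hx.integrableOn.sub hy.integrableOn

theorem leftLim_map (hx : IsJumpPath T J U x f) (Φ : E →L[ℝ] E) {t : ℝ} (h0 : 0 < t)
    (ht : t ≤ T) : Function.leftLim (fun s => Φ (x s)) t = Φ (Function.leftLim x t) :=
  leftLim_eq_of_tendsto ((Φ.continuous.tendsto _).comp (hx.tendsto_left t h0 ht))

theorem map [CompleteSpace E] (hx : IsJumpPath T J U x f) (Φ : E →L[ℝ] E)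
    (hU : ∀ a, Φ (U a) = U (Φ a)) :
    IsJumpPath T J U (fun t => Φ (x t)) (fun t => Φ (f t)) where
  tendsto_left t h0 ht := by
    rw [hx.leftLim_map Φ h0 ht]
    exact (Φ.continuous.tendsto _).comp (hx.tendsto_left t h0 ht)
  eq_jump t hJ h0 ht := by rw [hx.leftLim_map Φ h0 ht, hx.eq_jump t hJ h0 ht, hU]
  eq_leftLim t hJ h0 ht := by rw [hx.leftLim_map Φ h0 ht, ← hx.eq_leftLim t hJ h0 ht]
  flow t h0 ht := by
    filter_upwards [hx.flow t h0 ht, Ioo_mem_nhdsGT ht] with r h1 hr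
    rw [ContinuousLinearMap.integral_comp_comm Φ (hx.integrableOn_Ioc h0 hr.2.le), h1, map_add]
  integrableOn := Φ.integrable_comp hx.integrableOn

theorem continuousWithinAt_right (h : IsJumpPath T J U x f) {t : ℝ} (h0 : 0 ≤ t) (ht : t < T) :
    ContinuousWithinAt x (Ioi t) t := by
  have hprim : ContinuousOn (fun r => ∫ s in Ioc t r, f s) (Icc t T) :=
    intervalIntegral.continuousOn_primitive
      ((integrableOn_Icc_iff_integrableOn_Ioc).2 (h.integrableOn_Ioc h0 le_rfl))
  have h1 : Tendsto (fun r => x t + ∫ s in Ioc t r, f s) (𝓝[>] t) (𝓝 (x t)) := by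
    have := (hprim t (left_mem_Icc.2 ht.le)).tendsto
    rw [Ioc_self, setIntegral_empty] at this
    have h2 := this.mono_left (nhdsWithin_mono t Ioo_subset_Icc_self)
    rw [nhdsWithin_Ioo_eq_nhdsGT ht] at h2
    simpa using h2.const_add (x t)
  exact h1.congr' ((h.flow t h0 ht).mono fun r hr => hr.symm)

/-- An isometric jump is invisible to the norm: right continuity comes from the flow, and at a jump
the norm of the left limit already equals the norm of the value. -/
theorem continuousOn_norm (h : IsJumpPath T J U x f) (hU : ∀ a, ‖U a‖ = ‖a‖) :
    ContinuousOn (fun t => ‖x t‖) (Icc 0 T) := by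
  intro t ht
  have hr : ContinuousWithinAt (fun t => ‖x t‖) (Icc t T) t := by
    rcases ht.2.eq_or_lt with rfl | hlt
    · simp
    · exact ((continuousWithinAt_Ioi_iff_Ici.1
        (h.continuousWithinAt_right ht.1 hlt)).norm).mono Icc_subset_Ici_self
  have hl : ContinuousWithinAt (fun t => ‖x t‖) (Icc 0 t) t := by
    rcases ht.1.eq_or_lt with rfl | hlt
    · simp
    · have h1 : ‖x t‖ = ‖Function.leftLim x t‖ := by
        by_cases hJ : t ∈ J
        · rw [h.eq_jump t hJ hlt ht.2, hU]
        · rw [← h.eq_leftLim t hJ hlt ht.2]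
      have h2 : ContinuousWithinAt (fun t => ‖x t‖) (Iio t) t := by
        change Tendsto _ _ (𝓝 ‖x t‖)
        rw [h1]
        exact (h.tendsto_left t hlt ht.2).norm
      exact (continuousWithinAt_Iio_iff_Iic.1 h2).mono Icc_subset_Iic_self
  rw [← Icc_union_Icc_eq_Icc ht.1 ht.2]
  exact hl.union hr

theorem norm_le_add_integral (h : IsJumpPath T J U x f) (hU : ∀ a, ‖U a‖ = ‖a‖) {t : ℝ}
    (h0 : 0 ≤ t) (ht : t ≤ T) : ‖x t‖ ≤ ‖x 0‖ + ∫ s in Ioc 0 t, ‖f s‖ := by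
  have hi : IntegrableOn (fun s => ‖f s‖) (Ioc 0 T) := h.integrableOn.norm
  have hcont : ContinuousOn (fun t => ‖x t‖ - ∫ s in Ioc 0 t, ‖f s‖) (Icc 0 T) :=
    (h.continuousOn_norm hU).sub
      (intervalIntegral.continuousOn_primitive ((integrableOn_Icc_iff_integrableOn_Ioc).2 hi))
  have key := image_le_of_liminf_slope_right_le_deriv_boundary (B := fun _ => ‖x 0‖)
    (B' := fun _ => 0) hcont (by simp) continuousOn_const
    (fun s _ => hasDerivWithinAt_const _ _ _) (fun s hs r hr => ?_) ⟨h0, ht⟩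
  · linarith
  -- Only right slopes are needed, because the norm is continuous. Just after `s` the path follows
  -- the flow without jumps.
  · refine Eventually.frequently ?_
    filter_upwards [h.flow s hs.1 hs.2, Ioo_mem_nhdsGT hs.2] with r' h1 hr'
    refine lt_of_le_of_lt ?_ hr
    rw [slope_def_field]
    refine div_nonpos_of_nonpos_of_nonneg ?_ (sub_nonneg.2 hr'.1.le)
    have h2 : ∫ s in Ioc 0 r', ‖f s‖ = (∫ s in Ioc 0 s, ‖f s‖) + ∫ s in Ioc s r', ‖f s‖ := by
      rw [← Ioc_union_Ioc_eq_Ioc hs.1 hr'.1.le, setIntegral_union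
        (Ioc_disjoint_Ioc_of_le le_rfl) measurableSet_Ioc
        (hi.mono_set (Ioc_subset_Ioc_right hs.2.le))
        (hi.mono_set (Ioc_subset_Ioc hs.1 hr'.2.le))]
    have h3 : ‖x r'‖ ≤ ‖x s‖ + ∫ s in Ioc s r', ‖f s‖ := by
      rw [h1]
      exact (norm_add_le _ _).trans (by gcongr; exact norm_integral_le_integral_norm _)
    rw [h2]
    linarith

theorem exists_norm_le (h : IsJumpPath T J U x f) (hU : ∀ a, ‖U a‖ = ‖a‖) :
    ∃ C, ∀ t, 0 ≤ t → t ≤ T → ‖x t‖ ≤ C := by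
  obtain ⟨C, hC⟩ := isCompact_Icc.exists_bound_of_continuousOn (h.continuousOn_norm hU)
  exact ⟨C, fun t h0 ht => by simpa using hC t ⟨h0, ht⟩⟩

end IsJumpPath

/-- A bounded velocity orthogonal to the position conserves the norm. -/
theorem IsJumpPath.norm_eq_of_inner_eq_zero {F : Type*} [NormedAddCommGroup F]
    [InnerProductSpace ℝ F] [CompleteSpace F] {T : ℝ} {J : Set ℝ} {U : F → F} {x f : ℝ → F}
    (h : IsJumpPath T J U x f) (hU : ∀ a, ‖U a‖ = ‖a‖) {k : ℝ}
    (hk0 : 0 ≤ k) (hk : ∀ᵐ s ∂volume.restrict (Ioc 0 T), ‖f s‖ ≤ k)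
    (hf : ∀ᵐ s ∂volume.restrict (Ioc 0 T), inner ℝ (Function.leftLim x s) (f s) = 0) {t : ℝ}
    (h0 : 0 ≤ t) (ht : t ≤ T) : ‖x t‖ = ‖x 0‖ := by
  have key := constant_of_has_deriv_right_zero (f := fun t => ‖x t‖ ^ 2)
    ((h.continuousOn_norm hU).pow 2) (fun s hs => ?_) t ⟨h0, ht⟩
  · exact (sq_eq_sq₀ (norm_nonneg _) (norm_nonneg _)).1 key
  · obtain ⟨b, hb, hsub⟩ := (mem_nhdsGT_iff_exists_Ioo_subset' hs.2).1
      (inter_mem (h.flow s hs.1 hs.2) (Ioo_mem_nhdsGT hs.2))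
    have hae : ∀ {p : ℝ → Prop}, (∀ᵐ q ∂volume.restrict (Ioc 0 T), p q) → ∀ r ∈ Ioo s b,
        ∀ᵐ q, q ∈ Ioc s r → p q := fun hp r hr =>
      (ae_restrict_iff' measurableSet_Ioc).1
        (ae_restrict_of_ae_restrict_of_subset (Ioc_subset_Ioc hs.1 (hsub hr).2.2.le) hp)
    have hint : ∀ r ∈ Ioo s b, ‖∫ s in Ioc s r, f s‖ ≤ k * (r - s) := fun r hr => by
      have := norm_setIntegral_le_of_norm_le_const_ae' (μ := volume) (s := Ioc s r) (f := f)
        (C := k) (by simp) (hae hk r hr)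
      simpa [hr.1.le] using this
    have hdist : ∀ r ∈ Ioo s b, ‖x r - x s‖ ≤ k * (r - s) := fun r hr => by
      rw [(hsub hr).1, add_sub_cancel_left]
      exact hint r hr
    have hleft : ∀ r ∈ Ioo s b, ‖Function.leftLim x r - x s‖ ≤ k * (r - s) := fun r hr => by
      have h1 := ((h.tendsto_left r (hs.1.trans_lt hr.1) (hsub hr).2.2.le).sub_const (x s)).norm
      refine le_of_tendsto h1 ?_
      filter_upwards [Ioo_mem_nhdsLT hr.1] with q hq
      exact (hdist q ⟨hq.1, hq.2.trans hr.2⟩).trans (by gcongr; exact hq.2.le)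
    -- Orthogonality holds against the moving left limit, not against `x s`. Replacing one by the
    -- other costs a displacement of order `r - s`, so the inner product with the integrated
    -- velocity is of second order.
    have hinner : ∀ r ∈ Ioo s b, |inner ℝ (x s) (∫ s in Ioc s r, f s)| ≤ k ^ 2 * (r - s) ^ 2 := by
      intro r hr
      have hi := h.integrableOn_Ioc hs.1 (hsub hr).2.2.le
      rw [← integral_inner hi]
      have := norm_setIntegral_le_of_norm_le_const_ae' (μ := volume) (s := Ioc s r)
        (f := fun q => inner ℝ (x s) (f q)) (C := k * (r - s) * k) (by simp) ?_
      · simp only [measureReal_def, Real.volume_Ioc, Real.norm_eq_abs,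
          ENNReal.toReal_ofReal (sub_nonneg.2 hr.1.le)] at this
        exact this.trans (by ring_nf; rfl)
      · filter_upwards [hae hk r hr, hae hf r hr] with q hqk hqf hq
        have e : inner ℝ (x s) (f q) = inner ℝ (x s - Function.leftLim x q) (f q) := by
          rw [inner_sub_left, hqf hq, sub_zero]
        rw [e]
        refine (norm_inner_le_norm _ _).trans ?_
        have h3 := hleft q ⟨hq.1, hq.2.trans_lt hr.2⟩
        rw [norm_sub_rev] at h3
        exact mul_le_mul (h3.trans (by gcongr; exact hq.2)) (hqk hq) (norm_nonneg _)
          (mul_nonneg hk0 (sub_nonneg.2 hr.1.le))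
    rw [← hasDerivWithinAt_Ioi_iff_Ici, hasDerivWithinAt_iff_isLittleO]
    -- Expanding `‖x s + ∫ f‖²` leaves twice the inner product and `‖∫ f‖²`, at most `2k²(r - s)²`
    -- and `k²(r - s)²`. Hence the right derivative vanishes at every `s`, although `f` is
    -- controlled only almost everywhere.
    have hO : (fun r => ‖x r‖ ^ 2 - ‖x s‖ ^ 2 - (r - s) • (0 : ℝ)) =O[𝓝[>] s]
        fun r => (r - s) ^ 2 := by
      refine Asymptotics.IsBigO.of_bound (3 * k ^ 2) ?_
      filter_upwards [Ioo_mem_nhdsGT hb] with r hr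
      have h1 := hinner r hr
      have h2 := pow_le_pow_left₀ (norm_nonneg _) (hint r hr) 2
      rw [(hsub hr).1, norm_add_sq_real, smul_zero, sub_zero, Real.norm_eq_abs, Real.norm_eq_abs,
        abs_of_nonneg (sq_nonneg (r - s))]
      rw [abs_le] at h1 ⊢
      constructor <;> nlinarith [sq_nonneg ‖∫ s in Ioc s r, f s‖]
    refine hO.trans_isLittleO ?_
    have h1 : (fun r : ℝ => r - s) =o[𝓝[>] s] fun _ => (1 : ℝ) := by
      rw [Asymptotics.isLittleO_one_iff]
      have : Tendsto (fun r : ℝ => r - s) (𝓝 s) (𝓝 (s - s)) := tendsto_id.sub_const s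
      rw [sub_self] at this
      exact this.mono_left nhdsWithin_le_nhds
    simpa [sq] using h1.mul_isBigO (Asymptotics.isBigO_refl (fun r => r - s) (𝓝[>] s))

end JumpPath

/-! ### Càdlàg and counting paths -/

section Cadlag

variable {E : Type*} [NormedAddCommGroup E] {T : ℝ} {x : ℝ → E}

theorem IsCadlagOn.tendsto_leftLim (h : IsCadlagOn T x) {t : ℝ} (h0 : 0 < t) (ht : t ≤ T) :
    Tendsto x (𝓝[<] t) (𝓝 (Function.leftLim x t)) := by
  obtain ⟨l, hl⟩ := h.2 t h0 ht
  rwa [leftLim_eq_of_tendsto hl]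

/-- Near each time the one-sided limits bound the path on either side of that time; compactness of
`[0, T]` makes the bound global. -/
theorem IsCadlagOn.exists_norm_le (h : IsCadlagOn T x) :
    ∃ C, ∀ t, 0 ≤ t → t ≤ T → ‖x t‖ ≤ C := by
  suffices H : ∃ C, ∀ t ∈ Icc 0 T, ‖x t‖ ≤ C from
    H.imp fun C hC t h0 ht => hC t ⟨h0, ht⟩
  refine isCompact_Icc.induction_on (p := fun S => ∃ C, ∀ t ∈ S, ‖x t‖ ≤ C) ⟨0, by simp⟩
    (fun s t hst ⟨C, hC⟩ => ⟨C, fun r hr => hC r (hst hr)⟩)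
    (fun s t ⟨C, hC⟩ ⟨D, hD⟩ => ⟨max C D, fun r hr => hr.elim
      (fun h => (hC r h).trans (le_max_left _ _)) (fun h => (hD r h).trans (le_max_right _ _))⟩)
    (fun t ht => ?_)
  have hbdd : ∀ {F : Filter ℝ} {l : E}, Tendsto x F (𝓝 l) → ∀ᶠ r in F, ‖x r‖ ≤ ‖l‖ + 1 :=
    fun hl => (hl.norm.eventually (gt_mem_nhds (lt_add_one _))).mono fun r hr => hr.le
  have hr : ∃ C, ∀ᶠ r in 𝓝[Ioc t T] t, ‖x r‖ ≤ C := by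
    rcases ht.2.eq_or_lt with rfl | hlt
    · exact ⟨0, by simp⟩
    · exact ⟨_, (hbdd (h.1 t ht.1 hlt)).filter_mono
        (nhdsWithin_mono _ (Ioc_subset_Ioi_self.trans Ioi_subset_Ici_self))⟩
  have hl : ∃ C, ∀ᶠ r in 𝓝[Ico 0 t] t, ‖x r‖ ≤ C := by
    rcases ht.1.eq_or_lt with rfl | hlt
    · exact ⟨0, by simp⟩
    · exact ⟨_, (hbdd (h.tendsto_leftLim hlt ht.2)).filter_mono
        (nhdsWithin_mono _ Ico_subset_Iio_self)⟩
  obtain ⟨C, hC⟩ := hr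
  obtain ⟨D, hD⟩ := hl
  refine ⟨{r | ‖x r‖ ≤ max (max C D) ‖x t‖}, ?_, _, fun r hr => hr⟩
  have hsub : Icc 0 T ⊆ (Ioc t T ∪ Ico 0 t) ∪ {t} := by
    intro r hr
    rcases lt_trichotomy r t with hlt | rfl | hlt
    · exact Or.inl (Or.inr ⟨hr.1, hlt⟩)
    · exact Or.inr rfl
    · exact Or.inl (Or.inl ⟨hlt, hr.2⟩)
  refine nhdsWithin_mono _ hsub ?_
  rw [nhdsWithin_union, nhdsWithin_union, nhdsWithin_singleton]
  refine ⟨⟨hC.mono fun r hr => ?_, hD.mono fun r hr => ?_⟩, ?_⟩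
  · exact hr.trans ((le_max_left _ _).trans (le_max_left _ _))
  · exact hr.trans ((le_max_right _ _).trans (le_max_left _ _))
  · change ‖x t‖ ≤ max (max C D) ‖x t‖
    exact le_max_right _ _

theorem tendsto_ceil_sub_one_div (t : ℝ) :
    Tendsto (fun k : ℕ => ((⌈(k + 1 : ℝ) * t⌉ : ℝ) - 1) / (k + 1)) atTop (𝓝[<] t) := by
  have hk : ∀ k : ℕ, (0 : ℝ) < k + 1 := fun k => by positivity
  refine tendsto_nhdsWithin_iff.2 ⟨?_, Eventually.of_forall fun k => ?_⟩
  · have h1 : Tendsto (fun k : ℕ => t - 1 / ((k : ℝ) + 1)) atTop (𝓝 t) := by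
      simpa using tendsto_one_div_add_atTop_nhds_zero_nat.const_sub t
    refine tendsto_of_tendsto_of_tendsto_of_le_of_le h1 tendsto_const_nhds (fun k => ?_)
      (fun k => ?_)
    · have := Int.le_ceil ((k + 1 : ℝ) * t)
      rw [le_div_iff₀ (hk k), sub_mul, div_mul_cancel₀ _ (hk k).ne']
      linarith
    · have := Int.ceil_lt_add_one ((k + 1 : ℝ) * t)
      rw [div_le_iff₀ (hk k)]
      linarith
  · have := Int.ceil_lt_add_one ((k + 1 : ℝ) * t)
    rw [mem_Iio, div_lt_iff₀ (hk k)]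
    linarith

/-- The left limit at `t` is the limit of `x` along grid points strictly below `t`. These
approximations factor through the integers, so `x` itself need not be measurable. -/
theorem aestronglyMeasurable_leftLim
    (h : ∀ t, 0 < t → t ≤ T → Tendsto x (𝓝[<] t) (𝓝 (Function.leftLim x t))) :
    AEStronglyMeasurable (Function.leftLim x) (volume.restrict (Ioc 0 T)) := by
  refine aestronglyMeasurable_of_tendsto_ae atTop
    (f := fun (k : ℕ) t => x (((⌈(k + 1 : ℝ) * t⌉ : ℝ) - 1) / (k + 1))) (fun k => ?_) ?_
  · have h1 : StronglyMeasurable fun m : ℤ => x (((m : ℝ) - 1) / (k + 1)) :=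
      StronglyMeasurable.of_discrete
    exact (h1.comp_measurable (Int.measurable_ceil.comp
      (measurable_const.mul measurable_id))).aestronglyMeasurable
  · filter_upwards [ae_restrict_mem measurableSet_Ioc] with t ht
    exact (h t ht.1 ht.2).comp (tendsto_ceil_sub_one_div t)

end Cadlag

section Counting

variable {n : ℝ → ℕ}

/-- A monotone bounded integer path has a left limit, and convergence in a discrete space means
being eventually constant. -/
theorem MonotoneOn.eventually_eq_leftLim_nat (hn : MonotoneOn n (Ici 0)) {t : ℝ} (ht : 0 < t) :
    ∀ᶠ r in 𝓝[<] t, n r = Function.leftLim n t := by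
  have h1 := MonotoneOn.tendsto_nhdsWithin_Ioo_left (nonempty_Ioo.2 ht)
    (hn.mono (Ioo_subset_Ioi_self.trans Ioi_subset_Ici_self))
    ⟨n t, by
      rintro _ ⟨r, hr, rfl⟩
      exact hn hr.1.le ht.le hr.2.le⟩
  rw [← leftLim_eq_of_tendsto h1, nhds_discrete] at h1
  exact tendsto_pure.1 h1

theorem MonotoneOn.leftLim_nat_le (hn : MonotoneOn n (Ici 0)) {t : ℝ} (ht : 0 < t) :
    Function.leftLim n t ≤ n t := by
  obtain ⟨r, hr, hr'⟩ := ((hn.eventually_eq_leftLim_nat ht).and (Ioo_mem_nhdsLT ht)).exists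
  exact hr ▸ hn hr'.1.le ht.le hr'.2.le

theorem MonotoneOn.le_leftLim_nat (hn : MonotoneOn n (Ici 0)) {s t : ℝ} (hs : 0 ≤ s)
    (hst : s < t) : n s ≤ Function.leftLim n t := by
  obtain ⟨r, hr, hr'⟩ := ((hn.eventually_eq_leftLim_nat (hs.trans_lt hst)).and
    (Ioo_mem_nhdsLT hst)).exists
  exact hr ▸ hn hs (hs.trans hr'.1.le) hr'.1.le

/-- On jump times `n` is injective, since each jump raises it strictly, and its values stay below `n
t`. -/
theorem MonotoneOn.finite_jumps_nat (hn : MonotoneOn n (Ici 0)) (t : ℝ) :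
    (Ioc 0 t ∩ {s | Function.leftLim n s ≠ n s}).Finite := by
  refine Set.Finite.of_finite_image (f := n) ((Set.finite_Iic (n t)).subset ?_) ?_
  · rintro _ ⟨s, hs, rfl⟩
    exact hn hs.1.1.le (hs.1.1.le.trans hs.1.2) hs.1.2
  · have key : ∀ r s, 0 < r → Function.leftLim n s ≠ n s → r < s → n r < n s :=
      fun r s hr hs hrs => (hn.le_leftLim_nat hr.le hrs).trans_lt
        ((hn.leftLim_nat_le (hr.trans hrs)).lt_of_ne hs)
    intro r hr s hs hrs
    rcases lt_trichotomy r s with h | h | h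
    · exact absurd hrs (key r s hr.1.1 hs.2 h).ne
    · exact h
    · exact absurd hrs (key s r hs.1.1 hr.2 h).ne'

variable {E : Type*} [AddCommMonoid E] (X : ℝ → E)

theorem countingIntegral_eq_add (hn : MonotoneOn n (Ici 0)) {s t : ℝ} (hs : 0 ≤ s) (hst : s ≤ t) :
    countingIntegral n X t = countingIntegral n X s
      + ∑ᶠ r ∈ Ioc s t, (n r - Function.leftLim n r) • X r := by
  -- Finiteness is essential: `finsum` takes the value zero on an infinite support, and additivity
  -- would fail.
  have hfin : ∀ S ⊆ Ioc 0 t,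
      (S ∩ Function.support fun r => (n r - Function.leftLim n r) • X r).Finite := by
    refine fun S hS => (hn.finite_jumps_nat t).subset fun r hr => ⟨hS hr.1, fun h => hr.2 ?_⟩
    simp [h]
  unfold countingIntegral
  rw [← Ioc_union_Ioc_eq_Ioc hs hst, finsum_mem_union' (Ioc_disjoint_Ioc_of_le le_rfl)
    (hfin _ (Ioc_subset_Ioc_right hst)) (hfin _ (Ioc_subset_Ioc_left hs))]

theorem countingIntegral_eventually_right (hn : MonotoneOn n (Ici 0)) {t : ℝ} (ht : 0 ≤ t)
    (hr : ContinuousWithinAt n (Ici t) t) :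
    ∀ᶠ r in 𝓝[>] t, countingIntegral n X r = countingIntegral n X t := by
  have h1 : ∀ᶠ r in 𝓝[>] t, n r = n t := by
    have := hr.tendsto
    rw [nhds_discrete] at this
    exact (tendsto_pure.1 this).filter_mono (nhdsWithin_mono _ Ioi_subset_Ici_self)
  filter_upwards [h1, self_mem_nhdsWithin] with r h2 htr
  rw [countingIntegral_eq_add X hn ht (le_of_lt htr)]
  rw [finsum_mem_eq_zero_of_forall_eq_zero, add_zero]
  intro q hq
  have h3 := hn.le_leftLim_nat ht hq.1
  have h4 : n q ≤ n r := hn (ht.trans hq.1.le) (ht.trans (le_of_lt htr)) hq.2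
  rw [Nat.sub_eq_zero_of_le (by omega), zero_smul]

theorem countingIntegral_eventually_left (hn : MonotoneOn n (Ici 0)) {t : ℝ} (ht : 0 < t) :
    ∀ᶠ r in 𝓝[<] t, countingIntegral n X t
      = countingIntegral n X r + (n t - Function.leftLim n t) • X t := by
  filter_upwards [hn.eventually_eq_leftLim_nat ht, Ioo_mem_nhdsLT ht] with r hr htr
  rw [countingIntegral_eq_add X hn htr.1.le htr.2.le]
  congr 1
  have hz : ∀ q ∈ Ioo r t, (n q - Function.leftLim n q) • X q = 0 := by
    intro q hq
    have h3 := hn.le_leftLim_nat htr.1.le hq.1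
    have h4 := hn.le_leftLim_nat (htr.1.trans hq.1).le hq.2
    rw [Nat.sub_eq_zero_of_le (by omega), zero_smul]
  rw [← finsum_mem_singleton (f := fun q => (n q - Function.leftLim n q) • X q) (a := t)]
  refine finsum_mem_inter_support_eq' _ _ _ fun q hq => ?_
  constructor
  · intro h
    by_contra hne
    exact hq (hz q ⟨h.1, h.2.lt_of_ne hne⟩)
  · rintro rfl
    exact ⟨htr.2, le_rfl⟩

end Counting

/-- This turns the integrated equation into local rules. Unit jumps make the coefficient of `U z -
z` equal to one, so the state after a jump is exactly `U z`; right continuity of `n` leaves a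
jump-free interval after every time. -/
theorem isJumpPath_of_countingIntegral {E : Type*} [NormedAddCommGroup E] [NormedSpace ℝ E]
    {T : ℝ} {n : ℝ → ℕ} {U : E → E} {x f : ℝ → E} {x₀ : E} (hn : MonotoneOn n (Ici 0))
    (hright : ∀ t, 0 ≤ t → ContinuousWithinAt n (Ici t) t)
    (hunit : ∀ t, 0 < t → n t ≤ Function.leftLim n t + 1) (hf : IntegrableOn f (Ioc 0 T))
    (heq : ∀ t, 0 ≤ t → t ≤ T → x t = x₀ + (∫ s in Ioc 0 t, f s)
      + countingIntegral n (fun s => U (Function.leftLim x s) - Function.leftLim x s) t) :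
    IsJumpPath T {t | Function.leftLim n t ≠ n t} U x f := by
  set X : ℝ → E := fun s => U (Function.leftLim x s) - Function.leftLim x s with hX
  have hlim : ∀ t, 0 < t → t ≤ T →
      Tendsto x (𝓝[<] t) (𝓝 (x t - (n t - Function.leftLim n t) • X t)) := by
    intro t h0 ht
    have hprim : ContinuousOn (fun r => ∫ s in Ioc 0 r, f s) (Icc 0 T) :=
      intervalIntegral.continuousOn_primitive ((integrableOn_Icc_iff_integrableOn_Ioc).2 hf)
    have h1 : Tendsto (fun r => ∫ s in Ioc 0 r, f s) (𝓝[<] t) (𝓝 (∫ s in Ioc 0 t, f s)) := by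
      have h2 := (hprim t ⟨h0.le, ht⟩).tendsto.mono_left
        (nhdsWithin_mono t (Ioo_subset_Icc_self.trans (Icc_subset_Icc_right ht)))
      rwa [nhdsWithin_Ioo_eq_nhdsLT h0] at h2
    have h3 := (h1.const_add x₀).add_const
      (countingIntegral n X t - (n t - Function.leftLim n t) • X t)
    rw [heq t h0.le ht, add_sub_assoc]
    refine h3.congr' ?_
    filter_upwards [countingIntegral_eventually_left X hn h0, Ioo_mem_nhdsLT h0] with r hr htr
    rw [heq r htr.1.le (htr.2.le.trans ht), hr, add_sub_cancel_right]
  have hll : ∀ t, 0 < t → t ≤ T →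
      x t = Function.leftLim x t + (n t - Function.leftLim n t) • X t := fun t h0 ht =>
    (eq_sub_iff_add_eq.1 (leftLim_eq_of_tendsto (hlim t h0 ht))).symm
  refine ⟨fun t h0 ht => ?_, fun t hJ h0 ht => ?_, fun t hJ h0 ht => ?_, fun t h0 ht => ?_, hf⟩
  · have := hlim t h0 ht
    rwa [← leftLim_eq_of_tendsto this] at this
  · have h1 : n t - Function.leftLim n t = 1 := by
      have h2 := hunit t h0
      have h3 := (hn.leftLim_nat_le h0).lt_of_ne hJ
      omega
    have h4 := hll t h0 ht
    rw [h1, one_smul] at h4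
    rw [h4, hX]
    simp
  · have h1 : n t - Function.leftLim n t = 0 := by
      rw [not_not.1 hJ, Nat.sub_self]
    have h4 := hll t h0 ht
    rwa [h1, zero_smul, add_zero] at h4
  · filter_upwards [countingIntegral_eventually_right X hn h0 (hright t h0),
      Ioo_mem_nhdsGT ht] with r hr htr
    rw [heq r (h0.trans htr.1.le) htr.2.le, hr, heq t h0 ht.le,
      ← Ioc_union_Ioc_eq_Ioc h0 htr.1.le, setIntegral_union
        (Ioc_disjoint_Ioc_of_le le_rfl) measurableSet_Ioc
        (hf.mono_set (Ioc_subset_Ioc_right ht.le))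
        (hf.mono_set (Ioc_subset_Ioc h0 htr.2.le))]
    abel

/-! ### The Frobenius norm -/

section

open scoped MatrixOrder

theorem Matrix.PosSemidef.exists_conjTranspose_mul_self {n : Type*} [Fintype n]
    {A : Matrix n n ℂ} (hA : A.PosSemidef) :
    ∃ B : Matrix n n ℂ, A = B.conjTranspose * B := by
  classical
  exact CStarAlgebra.nonneg_iff_eq_star_mul_self.1 hA.nonneg

end

section Frobenius

/-- The topology of the Frobenius norm. -/
noncomputable abbrev frobeniusTopology {d : ℕ} : TopologicalSpace (Matrix (Fin d) (Fin d) ℂ) :=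
  (Matrix.frobeniusNormedAddCommGroup.toPseudoMetricSpace).toUniformSpace.toTopologicalSpace

attribute [local instance] Matrix.frobeniusNormedSpace
attribute [local instance] frobeniusTopology

open Matrix

variable {d : ℕ}

theorem frobenius_norm_sq {m n : Type*} [Fintype m] [Fintype n] (A : Matrix m n ℂ) :
    ‖A‖ ^ 2 = ∑ i, ∑ j, ‖A i j‖ ^ 2 := by
  rw [Matrix.frobenius_norm_def, ← Real.rpow_natCast, ← Real.rpow_mul (by positivity)]
  simp

theorem frobenius_norm_sq_eq_trace (A : Matrix (Fin d) (Fin d) ℂ) :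
    ‖A‖ ^ 2 = (Aᴴ * A).trace.re := by
  rw [frobenius_norm_sq, Finset.sum_comm]
  simp only [Matrix.trace, Matrix.diag, Matrix.mul_apply, Matrix.conjTranspose_apply,
    Complex.re_sum]
  refine Finset.sum_congr rfl fun i _ => Finset.sum_congr rfl fun j _ => ?_
  rw [Complex.star_def, mul_comm, Complex.mul_conj, Complex.normSq_eq_norm_sq, Complex.ofReal_re]

theorem norm_entry_le_frobenius (A : Matrix (Fin d) (Fin d) ℂ) (i j : Fin d) : ‖A i j‖ ≤ ‖A‖ := by
  refine (sq_le_sq₀ (norm_nonneg _) (norm_nonneg _)).1 ?_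
  rw [frobenius_norm_sq]
  exact (Finset.single_le_sum (f := fun j => ‖A i j‖ ^ 2) (fun _ _ => by positivity)
    (Finset.mem_univ j)).trans (Finset.single_le_sum (f := fun i => ∑ j, ‖A i j‖ ^ 2)
    (fun _ _ => by positivity) (Finset.mem_univ i))

theorem frobenius_norm_le_sum (A : Matrix (Fin d) (Fin d) ℂ) : ‖A‖ ≤ ∑ i, ∑ j, ‖A i j‖ := by
  refine (sq_le_sq₀ (norm_nonneg _) (by positivity)).1 ?_
  rw [frobenius_norm_sq]
  refine (Finset.sum_le_sum fun i _ => Finset.sum_sq_le_sq_sum_of_nonneg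
    (fun j _ => norm_nonneg (A i j))).trans ?_
  exact Finset.sum_sq_le_sq_sum_of_nonneg (fun i _ => by positivity)

/-- The real inner product `re tr (A† B)` of the Frobenius norm. -/
noncomputable abbrev frobeniusInnerProductSpace :
    InnerProductSpace ℝ (Matrix (Fin d) (Fin d) ℂ) where
  toNormedSpace := Matrix.frobeniusNormedSpace
  inner A B := (Aᴴ * B).trace.re
  norm_sq_eq_re_inner A := frobenius_norm_sq_eq_trace A
  conj_inner_symm A B := by
    change (Bᴴ * A).trace.re = _
    rw [← Matrix.conjTranspose_conjTranspose A, ← Matrix.conjTranspose_mul,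
      Matrix.trace_conjTranspose, Matrix.conjTranspose_conjTranspose]
    simp
  add_left A B C := by simp [Matrix.conjTranspose_add, Matrix.add_mul]
  smul_left A B r := by simp [Matrix.conjTranspose_smul]

theorem frobenius_norm_unitary_conj {L : Matrix (Fin d) (Fin d) ℂ}
    (hL : L ∈ Matrix.unitaryGroup (Fin d) ℂ) (A : Matrix (Fin d) (Fin d) ℂ) :
    ‖L * A * Lᴴ‖ = ‖A‖ := by
  have h1 : Lᴴ * L = 1 := Matrix.mem_unitaryGroup_iff'.1 hL
  refine (sq_eq_sq₀ (norm_nonneg _) (norm_nonneg _)).1 ?_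
  rw [frobenius_norm_sq_eq_trace, frobenius_norm_sq_eq_trace, Matrix.trace_mul_comm]
  simp only [Matrix.conjTranspose_mul, Matrix.conjTranspose_conjTranspose]
  have : L * A * Lᴴ * (L * (Aᴴ * Lᴴ)) = L * (A * Aᴴ * Lᴴ) := by
    simp only [Matrix.mul_assoc]
    rw [← Matrix.mul_assoc Lᴴ L, h1, Matrix.one_mul]
  rw [this, Matrix.trace_mul_comm, Matrix.mul_assoc, h1, Matrix.mul_one, Matrix.trace_mul_comm]

/-- This lets the final constant depend on the dimension through `‖L‖` alone. -/
theorem frobenius_norm_sq_of_mem_unitaryGroup {L : Matrix (Fin d) (Fin d) ℂ}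
    (hL : L ∈ Matrix.unitaryGroup (Fin d) ℂ) : ‖L‖ ^ 2 = d := by
  have h1 : Lᴴ * L = 1 := Matrix.mem_unitaryGroup_iff'.1 hL
  rw [frobenius_norm_sq_eq_trace, h1]
  simp

theorem IsDensityMatrix.norm_le_one {ρ : Matrix (Fin d) (Fin d) ℂ} (h : IsDensityMatrix ρ) :
    ‖ρ‖ ≤ 1 := by
  -- For `ρ = B†B` the trace is `‖B‖²`, so submultiplicativity gives the bound.
  obtain ⟨B, rfl⟩ := h.1.exists_conjTranspose_mul_self
  have h2 : ‖B‖ ^ 2 = 1 := by rw [frobenius_norm_sq_eq_trace, h.2, Complex.one_re]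
  calc ‖Bᴴ * B‖ ≤ ‖Bᴴ‖ * ‖B‖ := Matrix.frobenius_norm_mul _ _
    _ = 1 := by rw [Matrix.frobenius_norm_conjTranspose, ← sq, h2]

/-- The conjugate transpose as a real continuous linear map. -/
noncomputable def conjTransposeCLM :
    Matrix (Fin d) (Fin d) ℂ →L[ℝ] Matrix (Fin d) (Fin d) ℂ :=
  LinearMap.mkContinuous
    { toFun := fun A => Aᴴ
      map_add' := fun A B => Matrix.conjTranspose_add A B
      map_smul' := fun r A => by simp [Matrix.conjTranspose_smul] } 1
    (fun A => by
      rw [one_mul]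
      exact (Matrix.frobenius_norm_conjTranspose A).le)

@[simp] theorem conjTransposeCLM_apply (A : Matrix (Fin d) (Fin d) ℂ) :
    conjTransposeCLM A = Aᴴ := rfl

/-- An entry as a complex continuous linear map. -/
noncomputable def entryCLM (i j : Fin d) : Matrix (Fin d) (Fin d) ℂ →L[ℂ] ℂ :=
  LinearMap.mkContinuous (Matrix.entryLinearMap ℂ ℂ i j) 1
    (fun A => by
      rw [one_mul]
      exact norm_entry_le_frobenius A i j)

/-! ### Integrals of matrices -/

section Integral

variable {X : Type*} [MeasurableSpace X] {μ : Measure X}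
  {f g : X → Matrix (Fin d) (Fin d) ℂ}

theorem MatrixIntegrable.integrable (h : MatrixIntegrable μ f) : Integrable f μ := by
  have h1 : f = fun x => ∑ i, ∑ j, f x i j • Matrix.single i j (1 : ℂ) := by
    funext x
    conv_lhs => rw [Matrix.matrix_eq_sum_single (f x)]
    simp [Matrix.smul_single]
  rw [h1]
  exact integrable_finsetSum _ fun i _ => integrable_finsetSum _ fun j _ =>
    (h i j).smul_const _

theorem MeasureTheory.Integrable.matrixIntegral_eq (h : Integrable f μ) :
    matrixIntegral μ f = ∫ x, f x ∂μ := by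
  ext i j
  exact (entryCLM i j).integral_comp_comm h

end Integral

/-! ### Pair interactions -/

variable (a : Matrix (Fin d × Fin d) (Fin d × Fin d) ℂ)

/-- Cauchy-Schwarz over `(y, y')` in each entry, then summation over the entries. -/
theorem norm_partialInteraction_le (ρ : Matrix (Fin d) (Fin d) ℂ) :
    ‖partialInteraction a ρ‖ ≤ ‖a‖ * ‖ρ‖ := by
  refine (sq_le_sq₀ (norm_nonneg _) (by positivity)).1 ?_
  rw [mul_pow, frobenius_norm_sq, frobenius_norm_sq a, frobenius_norm_sq ρ]
  simp only [Fintype.sum_prod_type]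
  have key : ∀ x x', ‖partialInteraction a ρ x x'‖ ^ 2
      ≤ (∑ y, ∑ y', ‖a (x, y) (x', y')‖ ^ 2) * ∑ y, ∑ y', ‖ρ y y'‖ ^ 2 := by
    intro x x'
    simp only [← Fintype.sum_prod_type']
    refine le_trans ?_ (Finset.sum_mul_sq_le_sq_mul_sq Finset.univ
      (fun p : Fin d × Fin d => ‖a (x, p.1) (x', p.2)‖) (fun p => ‖ρ p.1 p.2‖))
    refine pow_le_pow_left₀ (norm_nonneg _) ?_ 2
    rw [Fintype.sum_prod_type]
    change ‖∑ y, ∑ y', a (x, y) (x', y') * star (ρ y y')‖ ≤ _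
    refine (norm_sum_le _ _).trans (Finset.sum_le_sum fun y _ => (norm_sum_le _ _).trans
      (Finset.sum_le_sum fun y' _ => ?_))
    rw [norm_mul, norm_star]
  refine (Finset.sum_le_sum fun x _ => Finset.sum_le_sum fun x' _ => key x x').trans ?_
  simp only [← Finset.sum_mul]
  refine mul_le_mul_of_nonneg_right (le_of_eq ?_) (by positivity)
  exact Finset.sum_congr rfl fun x _ => Finset.sum_comm

/-- `ρ ↦ A^ρ` as a real continuous linear map. -/
noncomputable def partialInteractionCLM :
    Matrix (Fin d) (Fin d) ℂ →L[ℝ] Matrix (Fin d) (Fin d) ℂ :=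
  LinearMap.mkContinuous
    { toFun := partialInteraction a
      map_add' := fun A B => by
        ext x x'
        simp [partialInteraction, mul_add, Finset.sum_add_distrib]
      map_smul' := fun r A => by
        ext x x'
        simp only [partialInteraction, Matrix.of_apply, Matrix.smul_apply, RingHom.id_apply,
          Finset.smul_sum, star_smul, star_trivial, mul_smul_comm] } ‖a‖
    (norm_partialInteraction_le a)

@[simp] theorem partialInteractionCLM_apply (ρ : Matrix (Fin d) (Fin d) ℂ) :
    partialInteractionCLM a ρ = partialInteraction a ρ := rfl

variable {a}

theorem IsPairInteraction.conjTranspose_partialInteraction (ha : IsPairInteraction a)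
    (ρ : Matrix (Fin d) (Fin d) ℂ) : (partialInteraction a ρ)ᴴ = partialInteraction a ρᴴ := by
  ext x x'
  simp only [partialInteraction, Matrix.conjTranspose_apply, Matrix.of_apply, star_sum, star_mul',
    star_star]
  rw [Finset.sum_comm]
  refine Finset.sum_congr rfl fun y _ => Finset.sum_congr rfl fun y' _ => ?_
  rw [ha.selfAdjoint.apply]

end Frobenius

/-! ### The cut norm controls the operator norm from `L^∞` to `L^1` -/

section CutNorm

/-- The set where `k` is nonnegative and its complement are the two test sets, whence the factor
two. -/
theorem integral_abs_le_of_abs_setIntegral_le {X : Type*} [MeasurableSpace X] {μ : Measure X}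
    {k : X → ℝ} (hk : Integrable k μ) (hm : Measurable k) {c : ℝ}
    (h : ∀ B, MeasurableSet B → |∫ x in B, k x ∂μ| ≤ c) : ∫ x, |k x| ∂μ ≤ 2 * c := by
  have hS : MeasurableSet {x | 0 ≤ k x} := measurableSet_le measurable_const hm
  rw [← integral_add_compl hS hk.abs]
  have h1 : ∫ x in {x | 0 ≤ k x}, |k x| ∂μ = ∫ x in {x | 0 ≤ k x}, k x ∂μ :=
    setIntegral_congr_fun hS fun x hx => abs_of_nonneg hx
  have h2 : ∫ x in {x | 0 ≤ k x}ᶜ, |k x| ∂μ = -∫ x in {x | 0 ≤ k x}ᶜ, k x ∂μ := by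
    rw [← integral_neg]
    exact setIntegral_congr_fun hS.compl fun x hx => abs_of_neg (not_le.1 hx)
  have h3 := (abs_le.1 (h _ hS)).2
  have h4 := (abs_le.1 (h _ hS.compl)).1
  rw [h1, h2]
  linarith

variable {K : I → I → ℝ}

theorem abs_setIntegral_le_cutNorm (hK1 : ∀ u v, |K u v| ≤ 1) {S B : Set I}
    (hS : MeasurableSet S) (hB : MeasurableSet B) :
    |∫ p in S ×ˢ B, K p.1 p.2 ∂(volume.prod volume)| ≤ cutNorm K := by
  refine le_ciSup (f := fun B : {S : Set I // MeasurableSet S} × {S : Set I // MeasurableSet S} =>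
    |∫ p in (B.1 : Set I) ×ˢ (B.2 : Set I), K p.1 p.2 ∂(volume.prod volume)|) ?_
    (⟨S, hS⟩, ⟨B, hB⟩)
  -- The family must be bounded above for the real supremum to dominate its members.
  refine ⟨1, ?_⟩
  rintro _ ⟨p, rfl⟩
  refine (norm_setIntegral_le_of_norm_le_const (C := 1)
    (f := fun q : I × I => K q.1 q.2) (measure_lt_top _ _)
    (fun (q : I × I) _ => hK1 q.1 q.2)).trans ?_
  rw [one_mul]
  exact measureReal_le_one

theorem cutNorm_nonneg (K : I → I → ℝ) : 0 ≤ cutNorm K :=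
  Real.iSup_nonneg fun _ => abs_nonneg _

theorem integrable_kernel_mul (hK : Measurable fun p : I × I => K p.1 p.2)
    (hK1 : ∀ u v, |K u v| ≤ 1) {f : I → ℝ} (hf : Measurable f) {b : ℝ}
    (hfb : ∀ᵐ v, |f v| ≤ b) :
    Integrable (fun p : I × I => K p.1 p.2 * f p.2) (volume.prod volume) := by
  refine Integrable.of_bound (hK.mul (hf.comp measurable_snd)).aestronglyMeasurable b ?_
  filter_upwards [(Measure.quasiMeasurePreserving_snd (μ := (volume : Measure I))).ae hfb]
    with p hp
  rw [norm_mul, Real.norm_eq_abs, Real.norm_eq_abs]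
  calc |K p.1 p.2| * |f p.2| ≤ 1 * |f p.2| := by gcongr; exact hK1 _ _
    _ ≤ b := by rwa [one_mul]

/-- Sign sets are chosen twice: first a set `S` in `u`, then, after Fubini and the bound on `f`, a
set `B` in `v`. Each choice costs a factor two. -/
theorem integral_abs_kernel_le (hK : Measurable fun p : I × I => K p.1 p.2)
    (hK1 : ∀ u v, |K u v| ≤ 1) {f : I → ℝ} (hf : Measurable f) {b : ℝ} (hb : 0 ≤ b)
    (hfb : ∀ᵐ v, |f v| ≤ b) :
    ∫ u, |∫ v, K u v * f v| ≤ 4 * b * cutNorm K := by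
  have hint := integrable_kernel_mul hK hK1 hf hfb
  have hKi : Integrable (fun p : I × I => K p.1 p.2) (volume.prod volume) :=
    Integrable.of_bound hK.aestronglyMeasurable 1 (Eventually.of_forall fun p => hK1 _ _)
  have hmeas : Measurable fun u => ∫ v, K u v * f v :=
    (StronglyMeasurable.integral_prod_right'
      (f := fun p : I × I => K p.1 p.2 * f p.2)
      (hK.mul (hf.comp measurable_snd)).stronglyMeasurable).measurable
  refine (integral_abs_le_of_abs_setIntegral_le hint.integral_prod_left hmeas
    (c := b * (2 * cutNorm K)) fun S hS => ?_).trans (by linarith)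
  have hrS : (volume.restrict S).prod (volume : Measure I)
      = (volume.prod volume).restrict (S ×ˢ univ) := by
    rw [← Measure.prod_restrict, Measure.restrict_univ]
  have hswap : ∫ u in S, ∫ v, K u v * f v = ∫ v, ∫ u in S, K u v * f v := by
    refine integral_integral_swap ?_
    rw [hrS]
    exact hint.restrict
  have hkS : Integrable (fun p : I × I => K p.1 p.2) ((volume.restrict S).prod volume) := by
    rw [hrS]
    exact hKi.restrict
  have hkm : Measurable fun v => ∫ u in S, K u v :=
    (StronglyMeasurable.integral_prod_left' (μ := volume.restrict S)
      (f := fun p : I × I => K p.1 p.2) hK.stronglyMeasurable).measurable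
  have hk : ∫ v, |∫ u in S, K u v| ≤ 2 * cutNorm K := by
    refine integral_abs_le_of_abs_setIntegral_le hkS.integral_prod_right hkm fun B hB => ?_
    have h1 : ∫ v in B, ∫ u in S, K u v
        = ∫ p in S ×ˢ B, K p.1 p.2 ∂(volume.prod volume) := by
      rw [setIntegral_prod _ hKi.integrableOn]
      refine (integral_integral_swap (f := fun u v => K u v) ?_).symm
      rw [Measure.prod_restrict]
      exact hKi.restrict
    rw [h1]
    exact abs_setIntegral_le_cutNorm hK1 hS hB
  rw [hswap]
  simp only [integral_mul_const]
  calc |∫ v, (∫ u in S, K u v) * f v| ≤ ∫ v, |(∫ u in S, K u v) * f v| :=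
        abs_integral_le_integral_abs
    _ ≤ ∫ v, b * |∫ u in S, K u v| := by
        refine integral_mono_of_nonneg (Eventually.of_forall fun _ => abs_nonneg _)
          (hkS.integral_prod_right.abs.const_mul b) ?_
        filter_upwards [hfb] with v hv
        rw [abs_mul, mul_comm]
        gcongr
    _ ≤ b * (2 * cutNorm K) := by
        rw [integral_const_mul]
        gcongr

theorem lintegral_enorm_kernel_le (hK : Measurable fun p : I × I => K p.1 p.2)
    (hK1 : ∀ u v, |K u v| ≤ 1) {f : I → ℂ} (hf : Measurable f) {b : ℝ} (hb : 0 ≤ b)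
    (hfb : ∀ᵐ v, ‖f v‖ ≤ b) :
    ∫⁻ u, ‖∫ v, K u v • f v‖ₑ ≤ ENNReal.ofReal (8 * b * cutNorm K) := by
  have hre : ∀ᵐ v, |(f v).re| ≤ b := hfb.mono fun v hv => (Complex.abs_re_le_norm _).trans hv
  have him : ∀ᵐ v, |(f v).im| ≤ b := hfb.mono fun v hv => (Complex.abs_im_le_norm _).trans hv
  have hKu : ∀ u, Measurable fun v => K u v := fun u => hK.comp measurable_prodMk_left
  have hint : ∀ u, Integrable fun v => K u v • f v := fun u => by
    refine Integrable.of_bound ((hKu u).smul hf).aestronglyMeasurable b ?_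
    filter_upwards [hfb] with v hv
    rw [norm_smul, Real.norm_eq_abs]
    calc |K u v| * ‖f v‖ ≤ 1 * ‖f v‖ := by gcongr; exact hK1 _ _
      _ ≤ b := by rwa [one_mul]
  have hI1 : Integrable fun u => ∫ v, K u v * (f v).re :=
    (integrable_kernel_mul hK hK1 (Complex.measurable_re.comp hf) hre).integral_prod_left
  have hI2 : Integrable fun u => ∫ v, K u v * (f v).im :=
    (integrable_kernel_mul hK hK1 (Complex.measurable_im.comp hf) him).integral_prod_left
  -- Real and imaginary parts are treated separately, which doubles the constant four to eight.
  have key : ∀ u, ‖∫ v, K u v • f v‖ₑ ≤ ENNReal.ofReal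
      (|∫ v, K u v * (f v).re| + |∫ v, K u v * (f v).im|) := fun u => by
    rw [← ofReal_norm]
    refine ENNReal.ofReal_le_ofReal ((Complex.norm_le_abs_re_add_abs_im _).trans (le_of_eq ?_))
    have e1 := Complex.reCLM.integral_comp_comm (hint u)
    have e2 := Complex.imCLM.integral_comp_comm (hint u)
    simp only [Complex.reCLM_apply, Complex.imCLM_apply, Complex.smul_re, Complex.smul_im,
      smul_eq_mul] at e1 e2
    rw [e1, e2]
  refine (lintegral_mono key).trans ?_
  rw [← ofReal_integral_eq_lintegral_ofReal
    (f := fun u => |∫ v, K u v * (f v).re| + |∫ v, K u v * (f v).im|) (hI1.abs.add hI2.abs)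
    (Eventually.of_forall fun u => by positivity)]
  refine ENNReal.ofReal_le_ofReal ?_
  rw [integral_add hI1.abs hI2.abs]
  have h1 := integral_abs_kernel_le hK hK1 (Complex.measurable_re.comp hf) hb hre
  have h2 := integral_abs_kernel_le hK hK1 (Complex.measurable_im.comp hf) hb him
  simp only [Function.comp_apply] at h1 h2
  refine (add_le_add h1 h2).trans (le_of_eq (by ring))

end CutNorm

/-! ### Grönwall estimates -/

section Gronwall

/-- The map `c ↦ F + c / 2` contracts to its fixed point `2F`, so any initial bound improves to `2F`
in the limit. Keeping the property `p` abstract allows bounds that hold almost surely and for all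
particles at once. -/
theorem iterate_contraction {p : ℝ → Prop} {F c : ℝ} (hF : 0 ≤ F) (hc : 0 ≤ c) (h : p c)
    (step : ∀ c, 0 ≤ c → p c → p (F + c / 2)) (k : ℕ) : p (2 * F + (c - 2 * F) / 2 ^ k) := by
  induction k with
  | zero => simpa using h
  | succ k ih =>
    have h1 : 0 ≤ 2 * F + (c - 2 * F) / 2 ^ k := by
      have h2 : 2 * F / 2 ^ k ≤ 2 * F :=
        div_le_self (by positivity) (one_le_pow₀ one_le_two)
      have h3 : 0 ≤ c / 2 ^ k := by positivity
      rw [sub_div]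
      linarith
    convert step _ h1 ih using 1
    ring

theorem tendsto_add_div_pow_mul (F c w : ℝ) :
    Tendsto (fun k : ℕ => (F + c / 2 ^ k) * w) atTop (𝓝 (F * w)) := by
  have h1 : Tendsto (fun k : ℕ => (F + c * (1 / 2) ^ k) * w) atTop (𝓝 ((F + c * 0) * w)) :=
    ((tendsto_pow_atTop_nhds_zero_of_lt_one (by norm_num) (by norm_num)).const_mul c
      |>.const_add F).mul_const w
  simpa [div_eq_mul_inv] using h1

theorem le_of_forall_le_add_div_pow {z F c w : ℝ} (h : ∀ k : ℕ, z ≤ (F + c / 2 ^ k) * w) :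
    z ≤ F * w :=
  ge_of_tendsto' (tendsto_add_div_pow_mul F c w) h

theorem setIntegral_exp_le {l : ℝ} (hl : 0 < l) {t : ℝ} (ht : 0 ≤ t) :
    ∫ s in Ioc 0 t, Real.exp (l * s) ≤ Real.exp (l * t) / l := by
  rw [← intervalIntegral.integral_of_le ht,
    intervalIntegral.integral_comp_mul_left (fun s => Real.exp s) hl.ne', integral_exp,
    smul_eq_mul, inv_mul_eq_div]
  gcongr
  linarith [Real.exp_pos (l * 0)]

theorem integrableOn_exp (l s t : ℝ) : IntegrableOn (fun s => Real.exp (l * s)) (Ioc s t) :=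
  ((by fun_prop : Continuous fun s => Real.exp (l * s)).integrableOn_Icc).mono_set
    Ioc_subset_Icc_self

/-- An integrable kernel is a contraction for a suitable exponential weight. -/
theorem exists_exp_weight {T : ℝ} {κ : ℝ → ℝ} (hκ : IntegrableOn κ (Ioc 0 T)) :
    ∃ l, 0 < l ∧ ∀ t, 0 ≤ t → t ≤ T →
      ∫ s in Ioc 0 t, κ s * Real.exp (l * s) ≤ Real.exp (l * t) / 2 := by
  have hlim : Tendsto (fun k : ℕ => ∫ s in Ioc 0 T, |κ s - min (κ s) k|) atTop
      (𝓝 (∫ s in Ioc 0 T, (0 : ℝ))) := by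
    refine tendsto_integral_of_dominated_convergence (fun s => |κ s|) (fun k => ?_) hκ.abs
      (fun k => Eventually.of_forall fun s => ?_) (Eventually.of_forall fun s => ?_)
    · exact (hκ.aestronglyMeasurable.sub
        (hκ.aestronglyMeasurable.inf aestronglyMeasurable_const)).norm
    · rw [Real.norm_eq_abs, abs_abs]
      have hk : (0 : ℝ) ≤ k := Nat.cast_nonneg k
      rcases le_total (κ s) k with h | h
      · simp [min_eq_left h]
      · rw [min_eq_right h, abs_of_nonneg (sub_nonneg.2 h), abs_of_nonneg (hk.trans h)]
        linarith
    · refine tendsto_const_nhds.congr' ?_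
      filter_upwards [eventually_ge_atTop ⌈κ s⌉₊] with k hk
      rw [min_eq_left ((Nat.le_ceil _).trans (Nat.cast_le.2 hk)), sub_self, abs_zero]
  rw [integral_zero] at hlim
  -- Truncation at `k` leaves a remainder of mass below `1/4`, and with weight `4k` the truncated
  -- part contributes at most `k / (4k) = 1/4`; together they give the factor `1/2`.
  obtain ⟨k, hk1, hk2⟩ := ((hlim.eventually (gt_mem_nhds (by norm_num : (0 : ℝ) < 1 / 4))).and
    (eventually_ge_atTop 1)).exists
  have hk0 : (0 : ℝ) < k := by exact_mod_cast hk2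
  refine ⟨4 * k, by positivity, fun t h0 ht => ?_⟩
  have hκt : IntegrableOn κ (Ioc 0 t) := hκ.mono_set (Ioc_subset_Ioc_right ht)
  have hr : IntegrableOn (fun s => |κ s - min (κ s) k|) (Ioc 0 T) :=
    (hκ.sub (hκ.inf (integrableOn_const (by simp)))).abs
  have hr' : IntegrableOn (fun s => |κ s - min (κ s) k|) (Ioc 0 t) :=
    hr.mono_set (Ioc_subset_Ioc_right ht)
  have hle : ∫ s in Ioc 0 t, κ s * Real.exp (4 * k * s) ≤
      ∫ s in Ioc 0 t, (k * Real.exp (4 * k * s)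
        + |κ s - min (κ s) k| * Real.exp (4 * k * t)) := by
    refine setIntegral_mono_on ?_ (((integrableOn_exp _ _ _).const_mul _).add
      (hr'.mul_const _)) measurableSet_Ioc fun s hs => ?_
    · refine Integrable.mul_bdd (c := Real.exp (4 * k * t)) hκt
        (by fun_prop : Continuous fun s => Real.exp (4 * k * s)).aestronglyMeasurable ?_
      filter_upwards [ae_restrict_mem measurableSet_Ioc] with s hs
      rw [Real.norm_eq_abs, Real.abs_exp]
      gcongr
      exact hs.2
    · have h1 : κ s ≤ k + |κ s - min (κ s) k| := by
        have := le_abs_self (κ s - min (κ s) k)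
        have := min_le_right (κ s) (k : ℝ)
        linarith
      calc κ s * Real.exp (4 * k * s)
          ≤ (k + |κ s - min (κ s) k|) * Real.exp (4 * k * s) := by gcongr
        _ = k * Real.exp (4 * k * s) + |κ s - min (κ s) k| * Real.exp (4 * k * s) := by ring
        _ ≤ _ := by gcongr; exact hs.2
  refine hle.trans ?_
  rw [integral_add ((integrableOn_exp _ _ _).const_mul _) (hr'.mul_const _), integral_const_mul,
    integral_mul_const]
  have h1 := setIntegral_exp_le (l := 4 * k) (by positivity) h0
  have h2 : ∫ s in Ioc 0 t, |κ s - min (κ s) k| ≤ 1 / 4 :=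
    (setIntegral_mono_set hr (Eventually.of_forall fun _ => abs_nonneg _)
      (Ioc_subset_Ioc_right ht).eventuallyLE).trans hk1.le
  calc (k : ℝ) * (∫ s in Ioc 0 t, Real.exp (4 * k * s))
        + (∫ s in Ioc 0 t, |κ s - min (κ s) k|) * Real.exp (4 * k * t)
      ≤ k * (Real.exp (4 * k * t) / (4 * k)) + 1 / 4 * Real.exp (4 * k * t) := by gcongr
    _ = Real.exp (4 * k * t) / 2 := by field_simp; ring

/-- In the weight `exp (l * t)` the kernel acts with norm at most `1/2`, so a bound `c` improves to
`F + c / 2`. The iteration starts from the qualitative boundedness of the path. The kernel `κ` is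
only integrable, as required before the means are known to be bounded. -/
theorem IsJumpPath.gronwall {E : Type*} [NormedAddCommGroup E] [NormedSpace ℝ E] {T : ℝ}
    {J : Set ℝ} {U : E → E} {x f : ℝ → E} (h : IsJumpPath T J U x f) (hU : ∀ a, ‖U a‖ = ‖a‖)
    {κ b : ℝ → ℝ} (hκ : IntegrableOn κ (Ioc 0 T)) (hb : IntegrableOn b (Ioc 0 T))
    (hκ0 : ∀ s, 0 ≤ κ s) (hb0 : ∀ s, 0 ≤ b s) {l : ℝ} (hl : 0 ≤ l)
    (hw : ∀ t, 0 ≤ t → t ≤ T → ∫ s in Ioc 0 t, κ s * Real.exp (l * s) ≤ Real.exp (l * t) / 2)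
    (hf : ∀ᵐ s ∂volume.restrict (Ioc 0 T), ‖f s‖ ≤ κ s * ‖Function.leftLim x s‖ + b s)
    {t : ℝ} (h0 : 0 ≤ t) (ht : t ≤ T) :
    ‖x t‖ ≤ 2 * (‖x 0‖ + ∫ s in Ioc 0 t, b s) * Real.exp (l * t) := by
  obtain ⟨C, hC⟩ := h.exists_norm_le hU
  have hbi : 0 ≤ ∫ s in Ioc 0 t, b s := integral_nonneg hb0
  have hexp : ∀ s, 0 ≤ s → 1 ≤ Real.exp (l * s) := fun s hs => Real.one_le_exp (by positivity)
  have hC0 : 0 ≤ C := (norm_nonneg _).trans (hC t h0 ht)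
  have key := iterate_contraction
    (p := fun c => ∀ s, 0 ≤ s → s ≤ t → ‖x s‖ ≤ c * Real.exp (l * s))
    (F := ‖x 0‖ + ∫ s in Ioc 0 t, b s) (c := C) (by positivity) hC0
    (fun s hs hst => (hC s hs (hst.trans ht)).trans (le_mul_of_one_le_right hC0 (hexp s hs)))
    (fun c hc hp s hs hst => ?_)
  · exact le_of_forall_le_add_div_pow fun k => key k t h0 le_rfl
  · have hsT := hst.trans ht
    have hκs : IntegrableOn (fun r => κ r * Real.exp (l * r)) (Ioc 0 s) := by
      refine Integrable.mul_bdd (c := Real.exp (l * s)) (hκ.mono_set (Ioc_subset_Ioc_right hsT))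
        (by fun_prop : Continuous fun s => Real.exp (l * s)).aestronglyMeasurable ?_
      filter_upwards [ae_restrict_mem measurableSet_Ioc] with r hr
      rw [Real.norm_eq_abs, Real.abs_exp]
      gcongr
      exact hr.2
    have hbs : IntegrableOn b (Ioc 0 s) := hb.mono_set (Ioc_subset_Ioc_right hsT)
    have h1 : ∫ r in Ioc 0 s, ‖f r‖ ≤ ∫ r in Ioc 0 s, (c * (κ r * Real.exp (l * r)) + b r) := by
      refine integral_mono_ae (h.integrableOn_Ioc le_rfl hsT).norm
        ((hκs.const_mul c).add hbs) ?_
      filter_upwards [ae_restrict_mem measurableSet_Ioc,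
        ae_restrict_of_ae_restrict_of_subset (Ioc_subset_Ioc_right hsT) hf] with r hr hfr
      have h2 := norm_leftLim_le (w := fun r => c * Real.exp (l * r)) hr.1
        (h.tendsto_left r hr.1 (hr.2.trans hsT)) (by fun_prop)
        fun q hq hqr => hp q hq (hqr.le.trans (hr.2.trans hst))
      refine hfr.trans ?_
      have := mul_le_mul_of_nonneg_left h2 (hκ0 r)
      linarith
    rw [integral_add (hκs.const_mul c) hbs, integral_const_mul] at h1
    have h3 := h.norm_le_add_integral hU hs hsT
    have h4 : ∫ r in Ioc 0 s, b r ≤ ∫ r in Ioc 0 t, b r :=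
      setIntegral_mono_set (hb.mono_set (Ioc_subset_Ioc_right ht))
        (Eventually.of_forall hb0) (Ioc_subset_Ioc_right hst).eventuallyLE
    have h5 := mul_le_mul_of_nonneg_left (hw s hs hsT) hc
    have h6 : ‖x 0‖ + ∫ r in Ioc 0 t, b r
        ≤ (‖x 0‖ + ∫ r in Ioc 0 t, b r) * Real.exp (l * s) :=
      le_mul_of_one_le_right (by positivity) (hexp s hs)
    linarith

end Gronwall

/-! ### Solutions are bounded Hermitian jump paths -/

section Solution

open Matrix

/-- Placed before `frobeniusTopology` becomes a local instance here; `integrableOn_commutatorDrift`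
carries it over to that topology by definitional equality. -/
theorem continuous_commutator {d : ℕ} :
    Continuous fun p : Matrix (Fin d) (Fin d) ℂ × Matrix (Fin d) (Fin d) ℂ =>
      (-Complex.I) • (p.1 * p.2 - p.2 * p.1) :=
  (continuous_mul.sub (continuous_mul.comp continuous_swap)).const_smul (-Complex.I)

attribute [local instance] Matrix.frobeniusNormedSpace
attribute [local instance] frobeniusTopology

variable {d : ℕ}

/-- The velocity `-i [K_s, x_{s-}]`. -/
noncomputable def commutatorDrift (K x : ℝ → Matrix (Fin d) (Fin d) ℂ) (s : ℝ) :
    Matrix (Fin d) (Fin d) ℂ :=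
  (-Complex.I) • (K s * Function.leftLim x s - Function.leftLim x s * K s)

theorem norm_commutator_le (A B : Matrix (Fin d) (Fin d) ℂ) :
    ‖(-Complex.I) • (A * B - B * A)‖ ≤ 2 * ‖A‖ * ‖B‖ := by
  rw [norm_smul, norm_neg, Complex.norm_I, one_mul]
  refine (norm_sub_le _ _).trans ?_
  have h1 := Matrix.frobenius_norm_mul A B
  have h2 := Matrix.frobenius_norm_mul B A
  linarith [mul_comm ‖B‖ ‖A‖]

theorem norm_commutatorDrift_le (K x : ℝ → Matrix (Fin d) (Fin d) ℂ) (s : ℝ) :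
    ‖commutatorDrift K x s‖ ≤ 2 * ‖K s‖ * ‖Function.leftLim x s‖ :=
  norm_commutator_le _ _

theorem norm_commutator_sub_le (A B x y : Matrix (Fin d) (Fin d) ℂ) :
    ‖(-Complex.I) • (A * x - x * A) - (-Complex.I) • (B * y - y * B)‖
      ≤ 2 * ‖A‖ * ‖x - y‖ + 2 * ‖A - B‖ * ‖y‖ := by
  have h : (-Complex.I) • (A * x - x * A) - (-Complex.I) • (B * y - y * B)
      = (-Complex.I) • (A * (x - y) - (x - y) * A)
        + (-Complex.I) • ((A - B) * y - y * (A - B)) := by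
    rw [← smul_sub, ← smul_add]
    congr 1
    simp only [Matrix.mul_sub, Matrix.sub_mul]
    abel
  rw [h]
  exact (norm_add_le _ _).trans (add_le_add (norm_commutator_le _ _) (norm_commutator_le _ _))

/-- Both `tr (x† A x)` and `tr (x† x A)` are real, so multiplication by `-i` leaves no real part.
The matrix `x` itself may be arbitrary. -/
theorem inner_commutator_eq_zero {A : Matrix (Fin d) (Fin d) ℂ} (hA : A.IsHermitian)
    (x : Matrix (Fin d) (Fin d) ℂ) :
    (xᴴ * ((-Complex.I) • (A * x - x * A))).trace.re = 0 := by
  have him : ∀ B : Matrix (Fin d) (Fin d) ℂ, B.trace = Bᴴ.trace → B.trace.im = 0 := fun B hB => by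
    rw [Matrix.trace_conjTranspose] at hB
    exact Complex.conj_eq_iff_im.1 hB.symm
  have h1 := him (xᴴ * (A * x)) (by
    simp only [Matrix.conjTranspose_mul, Matrix.conjTranspose_conjTranspose, hA.eq,
      Matrix.mul_assoc])
  have h2 := him (xᴴ * (x * A)) (by
    simp only [Matrix.conjTranspose_mul, Matrix.conjTranspose_conjTranspose, hA.eq]
    rw [← Matrix.mul_assoc, Matrix.trace_mul_comm, Matrix.mul_assoc])
  rw [Matrix.mul_smul, Matrix.trace_smul, Matrix.mul_sub, Matrix.trace_sub]
  simp [h1, h2]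

theorem integrableOn_commutatorDrift {T : ℝ} {K x : ℝ → Matrix (Fin d) (Fin d) ℂ}
    (hK : IntegrableOn K (Ioc 0 T)) (hx : IsCadlagOn T x) :
    IntegrableOn (commutatorDrift K x) (Ioc 0 T) := by
  obtain ⟨C, hC⟩ : ∃ C, ∀ t, 0 ≤ t → t ≤ T → ‖x t‖ ≤ C := hx.exists_norm_le
  have hl : ∀ s, 0 < s → s ≤ T → Tendsto x (𝓝[<] s) (𝓝 (Function.leftLim x s)) :=
    fun s h0 hs => hx.tendsto_leftLim h0 hs
  have hxm : AEStronglyMeasurable (Function.leftLim x) (volume.restrict (Ioc 0 T)) :=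
    aestronglyMeasurable_leftLim hl
  have hKm : AEStronglyMeasurable K (volume.restrict (Ioc 0 T)) := hK.aestronglyMeasurable
  have hcont : Continuous fun p : Matrix (Fin d) (Fin d) ℂ × Matrix (Fin d) (Fin d) ℂ =>
      (-Complex.I) • (p.1 * p.2 - p.2 * p.1) := continuous_commutator
  have hm := hcont.comp_aestronglyMeasurable (hKm.prodMk hxm)
  refine Integrable.mono' (hK.norm.mul_const (2 * C)) hm ?_
  filter_upwards [ae_restrict_mem measurableSet_Ioc] with s hs
  refine (norm_commutatorDrift_le K x s).trans ?_
  have h1 : ‖Function.leftLim x s‖ ≤ C := norm_leftLim_le (w := fun _ => C) hs.1 (hl s hs.1 hs.2)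
    continuousAt_const fun r h0 hr => hC r h0 (hr.le.trans hs.2)
  have := mul_le_mul_of_nonneg_left h1 (norm_nonneg (K s))
  linarith

/-! ### The mean field -/

variable {a : Matrix (Fin d × Fin d) (Fin d × Fin d) ℂ} {W : I → I → ℝ}

theorem norm_smul_partialInteraction_le {w : ℝ} (hw : |w| ≤ 1) (ρ : Matrix (Fin d) (Fin d) ℂ) :
    ‖w • partialInteraction a ρ‖ ≤ ‖a‖ * ‖ρ‖ := by
  rw [norm_smul, Real.norm_eq_abs]
  exact (mul_le_of_le_one_left (norm_nonneg _) hw).trans (norm_partialInteraction_le a ρ)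

theorem integrable_smul_partialInteraction {X : Type*} [MeasurableSpace X] {μ : Measure X}
    {w : X → ℝ} (hw : Measurable w) (hw1 : ∀ x, |w x| ≤ 1) {m : X → Matrix (Fin d) (Fin d) ℂ}
    (hm : Integrable m μ) : Integrable (fun x => w x • partialInteraction a (m x)) μ := by
  refine Integrable.mono' (hm.norm.const_mul ‖a‖)
    (hw.aestronglyMeasurable.smul
      ((partialInteractionCLM a).continuous.comp_aestronglyMeasurable hm.aestronglyMeasurable))
    (Eventually.of_forall fun x => norm_smul_partialInteraction_le (hw1 x) _)

theorem IsGraphon.abs_le_one (hW : IsGraphon W) (u v : I) : |W u v| ≤ 1 :=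
  abs_le.2 ⟨by linarith [hW.nonneg u v], hW.le_one u v⟩

theorem IsGraphon.measurable_right (hW : IsGraphon W) (u : I) : Measurable (W u) :=
  hW.measurable.comp measurable_prodMk_left

variable {Ω : Type*} [MeasurableSpace Ω] {P : Measure Ω}
  {ℱ : Filtration ℝ (inferInstance : MeasurableSpace Ω)} {N : I → ℝ → Ω → ℕ} {T : ℝ}
  {H L : Matrix (Fin d) (Fin d) ℂ} {ρ₀ : Matrix (Fin d) (Fin d) ℂ}
  {γ : I → ℝ → Ω → Matrix (Fin d) (Fin d) ℂ}

theorem effectiveHamiltonian_eq (hW : IsGraphon W) {s : ℝ}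
    (hm : Integrable fun v => leftMean P γ s v) (u : I) :
    effectiveHamiltonian P H a W γ s u
      = H + ∫ v, W u v • partialInteraction a (leftMean P γ s v) := by
  have h := integrable_smul_partialInteraction (a := a) (hW.measurable_right u)
    (hW.abs_le_one u) hm
  rw [← h.matrixIntegral_eq]
  simp only [effectiveHamiltonian, Complex.coe_smul]

namespace IsJumpGraphonSolution

theorem integrable_leftMean (h : IsJumpGraphonSolution P ℱ N T H L a W ρ₀ γ) :
    Integrable (fun p : ℝ × I => leftMean P γ p.1 p.2)
      ((volume.restrict (Ioc 0 T)).prod volume) :=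
  h.integrable_mean.integrable

theorem ae_integrable_leftMean (h : IsJumpGraphonSolution P ℱ N T H L a W ρ₀ γ) :
    ∀ᵐ s ∂volume.restrict (Ioc 0 T), Integrable fun v => leftMean P γ s v :=
  h.integrable_leftMean.prod_right_ae

theorem integrable_leftLim (h : IsJumpGraphonSolution P ℱ N T H L a W ρ₀ γ) {s : ℝ} (h0 : 0 < s)
    (hs : s ≤ T) (v : I) : Integrable (fun ω => Function.leftLim (fun r => γ v r ω) s) P :=
  MatrixIntegrable.integrable (h.integrable_left v s h0 hs)

theorem leftMean_eq (h : IsJumpGraphonSolution P ℱ N T H L a W ρ₀ γ) {s : ℝ} (h0 : 0 < s)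
    (hs : s ≤ T) (v : I) :
    leftMean P γ s v = ∫ ω, Function.leftLim (fun r => γ v r ω) s ∂P :=
  (h.integrable_leftLim h0 hs v).matrixIntegral_eq

theorem integrableOn_effectiveHamiltonian (h : IsJumpGraphonSolution P ℱ N T H L a W ρ₀ γ)
    (hW : IsGraphon W) (u : I) :
    IntegrableOn (fun s => effectiveHamiltonian P H a W γ s u) (Ioc 0 T) := by
  have h1 := (integrable_smul_partialInteraction (a := a) (w := fun p : ℝ × I => W u p.2)
    ((hW.measurable_right u).comp measurable_snd) (fun p => hW.abs_le_one u p.2)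
    h.integrable_leftMean).integral_prod_left
  refine ((integrableOn_const (C := H) (by simp)).add h1).congr ?_
  filter_upwards [h.ae_integrable_leftMean] with s hs
  exact (effectiveHamiltonian_eq hW hs u).symm

/-- The exceptional times do not depend on `u`, and neither does the bound; this makes the next
estimates uniform over the particles. -/
theorem ae_norm_effectiveHamiltonian_le (h : IsJumpGraphonSolution P ℱ N T H L a W ρ₀ γ)
    (hW : IsGraphon W) : ∀ᵐ s ∂volume.restrict (Ioc 0 T), ∀ u,
      ‖effectiveHamiltonian P H a W γ s u‖ ≤ ‖H‖ + ‖a‖ * ∫ v, ‖leftMean P γ s v‖ := by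
  filter_upwards [h.ae_integrable_leftMean] with s hs u
  rw [effectiveHamiltonian_eq hW hs u, ← integral_const_mul]
  refine (norm_add_le _ _).trans (add_le_add le_rfl ?_)
  exact norm_integral_le_of_norm_le (hs.norm.const_mul _)
    (Eventually.of_forall fun v => norm_smul_partialInteraction_le (hW.abs_le_one u v) _)

theorem isJumpPath (h : IsJumpGraphonSolution P ℱ N T H L a W ρ₀ γ) (hW : IsGraphon W)
    (hN : ∀ u, IsUnitPoissonProcess P ℱ (N u)) (hT : 0 < T) (u : I) : ∀ᵐ ω ∂P,
      IsJumpPath T {t | Function.leftLim (fun r => N u r ω) t ≠ N u t ω} (fun A => L * A * Lᴴ)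
        (fun t => γ u t ω)
        (commutatorDrift (fun s => effectiveHamiltonian P H a W γ s u) fun t => γ u t ω) ∧
      γ u 0 ω = ρ₀ := by
  filter_upwards [h.cadlag u, h.equation u, (hN u).mono, (hN u).rightCont, (hN u).unitJumps]
    with ω hc heq hmono hright hunit
  have hint := integrableOn_commutatorDrift (h.integrableOn_effectiveHamiltonian hW u) hc
  refine ⟨isJumpPath_of_countingIntegral (x₀ := ρ₀) hmono hright hunit hint fun t h0 ht => ?_, ?_⟩
  · have h1 : IntegrableOn (commutatorDrift (fun s => effectiveHamiltonian P H a W γ s u)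
        fun t => γ u t ω) (Ioc 0 t) := hint.mono_set (Ioc_subset_Ioc_right ht)
    rw [← h1.matrixIntegral_eq]
    exact heq t h0 ht
  · rw [heq 0 le_rfl hT.le]
    ext i j
    simp [countingIntegral, matrixIntegral]

/-- A first bound that needs no Hermiticity. It depends on the solution through its means and serves
only to start the argument of `ae_isHermitian` and to bound the velocity in `ae_norm_eq`. -/
theorem exists_norm_le [IsProbabilityMeasure P] (h : IsJumpGraphonSolution P ℱ N T H L a W ρ₀ γ) (hW : IsGraphon W)
    (hN : ∀ u, IsUnitPoissonProcess P ℱ (N u)) (hT : 0 < T)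
    (hL : L ∈ Matrix.unitaryGroup (Fin d) ℂ) :
    ∃ B, 0 ≤ B ∧ ∀ u, ∀ᵐ ω ∂P, ∀ t, 0 ≤ t → t ≤ T → ‖γ u t ω‖ ≤ B := by
  have hκ : IntegrableOn (fun s => 2 * (‖H‖ + ‖a‖ * ∫ v, ‖leftMean P γ s v‖)) (Ioc 0 T) :=
    ((integrableOn_const (C := ‖H‖) (by simp)).add
      (h.integrable_leftMean.norm.integral_prod_left.const_mul ‖a‖)).const_mul 2
  obtain ⟨l, hl, hw⟩ := exists_exp_weight hκ
  refine ⟨2 * (‖ρ₀‖ + ∫ s in Ioc 0 T, (0 : ℝ)) * Real.exp (l * T), by simp; positivity,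
    fun u => ?_⟩
  filter_upwards [h.isJumpPath hW hN hT u] with ω hω t h0 ht
  have h1 := hω.1.gronwall (frobenius_norm_unitary_conj hL) hκ (b := fun _ => 0) (by simp)
    (fun s => by positivity) (fun _ => le_rfl) hl.le hw ?_ h0 ht
  · refine h1.trans ?_
    rw [hω.2]
    simp only [integral_zero]
    gcongr
  · filter_upwards [h.ae_norm_effectiveHamiltonian_le hW] with s hs
    refine (norm_commutatorDrift_le _ _ s).trans ?_
    rw [add_zero]
    gcongr
    exact hs u

theorem ae_norm_leftLim_le (h : IsJumpGraphonSolution P ℱ N T H L a W ρ₀ γ) {B : ℝ} {u : I}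
    (hB : ∀ᵐ ω ∂P, ∀ t, 0 ≤ t → t ≤ T → ‖γ u t ω‖ ≤ B) :
    ∀ᵐ ω ∂P, ∀ s, 0 < s → s ≤ T → ‖Function.leftLim (fun r => γ u r ω) s‖ ≤ B := by
  filter_upwards [h.cadlag u, hB] with ω hc hω s h0 hs
  exact norm_leftLim_le (w := fun _ => B) h0 (hc.tendsto_leftLim h0 hs) continuousAt_const
    fun r hr hrs => hω r hr (hrs.le.trans hs)

theorem norm_leftMean_le [IsProbabilityMeasure P] (h : IsJumpGraphonSolution P ℱ N T H L a W ρ₀ γ) {B : ℝ} {u : I}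
    (hB : ∀ᵐ ω ∂P, ∀ t, 0 ≤ t → t ≤ T → ‖γ u t ω‖ ≤ B) {s : ℝ} (h0 : 0 < s) (hs : s ≤ T) :
    ‖leftMean P γ s u‖ ≤ B := by
  rw [h.leftMean_eq h0 hs]
  simpa using norm_integral_le_of_norm_le_const
    ((h.ae_norm_leftLim_le hB).mono fun ω hω => hω s h0 hs)

theorem ae_norm_effectiveHamiltonian_le_of_norm_le
    [IsProbabilityMeasure P] (h : IsJumpGraphonSolution P ℱ N T H L a W ρ₀ γ) (hW : IsGraphon W) {B : ℝ}
    (hB : ∀ u, ∀ᵐ ω ∂P, ∀ t, 0 ≤ t → t ≤ T → ‖γ u t ω‖ ≤ B) :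
    ∀ᵐ s ∂volume.restrict (Ioc 0 T), ∀ u,
      ‖effectiveHamiltonian P H a W γ s u‖ ≤ ‖H‖ + ‖a‖ * B := by
  filter_upwards [h.ae_norm_effectiveHamiltonian_le hW, h.ae_integrable_leftMean,
    ae_restrict_mem measurableSet_Ioc] with s h1 h2 hs u
  refine (h1 u).trans ?_
  gcongr
  calc ∫ v, ‖leftMean P γ s v‖ ≤ ∫ _ : I, B :=
        integral_mono h2.norm (integrable_const _) fun v => h.norm_leftMean_le (hB v) hs.1 hs.2
    _ = B := by simp

end IsJumpGraphonSolution

end Solution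

/-! ### Solutions are Hermitian and have norm at most one -/

section Hermitian

open Matrix

attribute [local instance] Matrix.frobeniusNormedSpace
attribute [local instance] frobeniusTopology

variable {d : ℕ} {a : Matrix (Fin d × Fin d) (Fin d × Fin d) ℂ} {W : I → I → ℝ}

theorem norm_leftLim_sub_le {x y : ℝ → Matrix (Fin d) (Fin d) ℂ} {s : ℝ} (h0 : 0 < s)
    (hx : Tendsto x (𝓝[<] s) (𝓝 (Function.leftLim x s)))
    (hy : Tendsto y (𝓝[<] s) (𝓝 (Function.leftLim y s))) {w : ℝ → ℝ} (hw : ContinuousAt w s)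
    (hxy : ∀ t, 0 ≤ t → t < s → ‖x t - y t‖ ≤ w t) :
    ‖Function.leftLim x s - Function.leftLim y s‖ ≤ w s := by
  have h1 := hx.sub hy
  have h2 := leftLim_eq_of_tendsto h1
  rw [← h2] at h1 ⊢
  exact norm_leftLim_le h0 h1 hw hxy

variable {Ω : Type*} [MeasurableSpace Ω] {P : Measure Ω}
  {ℱ : Filtration ℝ (inferInstance : MeasurableSpace Ω)} {N : I → ℝ → Ω → ℕ} {T : ℝ}
  {H L : Matrix (Fin d) (Fin d) ℂ} {ρ₀ : Matrix (Fin d) (Fin d) ℂ}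
  {γ : I → ℝ → Ω → Matrix (Fin d) (Fin d) ℂ}

theorem effectiveHamiltonian_sub_conjTranspose (hH : H.IsHermitian) (ha : IsPairInteraction a)
    (hW : IsGraphon W) {s : ℝ} (hm : Integrable fun v => leftMean P γ s v) (u : I) :
    effectiveHamiltonian P H a W γ s u - (effectiveHamiltonian P H a W γ s u)ᴴ
      = ∫ v, W u v • partialInteraction a (leftMean P γ s v - (leftMean P γ s v)ᴴ) := by
  have h1 := integrable_smul_partialInteraction (a := a) (hW.measurable_right u)
    (hW.abs_le_one u) hm
  have h2 : Integrable (fun v => (W u v • partialInteraction a (leftMean P γ s v))ᴴ) :=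
    conjTransposeCLM.integrable_comp h1
  have h3 : (∫ v, W u v • partialInteraction a (leftMean P γ s v))ᴴ
      = ∫ v, (W u v • partialInteraction a (leftMean P γ s v))ᴴ :=
    (conjTransposeCLM.integral_comp_comm h1).symm
  rw [effectiveHamiltonian_eq hW hm, Matrix.conjTranspose_add, hH.eq, add_sub_add_left_eq_sub, h3,
    ← integral_sub h1 h2]
  refine integral_congr_ae (Eventually.of_forall fun v => ?_)
  simp only
  rw [Matrix.conjTranspose_smul, star_trivial, ha.conjTranspose_partialInteraction, ← smul_sub,
    ← partialInteractionCLM_apply, ← partialInteractionCLM_apply, ← map_sub,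
    partialInteractionCLM_apply]

namespace IsJumpGraphonSolution

theorem norm_leftMean_sub_conjTranspose_le [IsProbabilityMeasure P]
    (h : IsJumpGraphonSolution P ℱ N T H L a W ρ₀ γ) {w : ℝ → ℝ} {v : I}
    (hv : ∀ᵐ ω ∂P, ∀ t, 0 ≤ t → t ≤ T → ‖γ v t ω - (γ v t ω)ᴴ‖ ≤ w t) {s : ℝ}
    (hw : ContinuousAt w s) (h0 : 0 < s) (hs : s ≤ T) :
    ‖leftMean P γ s v - (leftMean P γ s v)ᴴ‖ ≤ w s := by
  have h1 := h.integrable_leftLim h0 hs v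
  have h2 : Integrable (fun ω => (Function.leftLim (fun r => γ v r ω) s)ᴴ) P :=
    conjTransposeCLM.integrable_comp h1
  have h3 : (∫ ω, Function.leftLim (fun r => γ v r ω) s ∂P)ᴴ
      = ∫ ω, (Function.leftLim (fun r => γ v r ω) s)ᴴ ∂P :=
    (conjTransposeCLM.integral_comp_comm h1).symm
  rw [h.leftMean_eq h0 hs, h3, ← integral_sub h1 h2]
  suffices H : ∀ᵐ ω ∂P, ‖Function.leftLim (fun r => γ v r ω) s
      - (Function.leftLim (fun r => γ v r ω) s)ᴴ‖ ≤ w s by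
    simpa using norm_integral_le_of_norm_le_const H
  filter_upwards [h.cadlag v, hv] with ω hc hω
  have h4 : Tendsto (fun r => γ v r ω) (𝓝[<] s) (𝓝 (Function.leftLim (fun r => γ v r ω) s)) :=
    hc.tendsto_leftLim h0 hs
  have h5 : Tendsto (fun r => (γ v r ω)ᴴ) (𝓝[<] s)
      (𝓝 (Function.leftLim (fun r => γ v r ω) s)ᴴ) :=
    (conjTransposeCLM.continuous.tendsto _).comp h4
  have h6 := leftLim_eq_of_tendsto h5
  rw [← h6] at h5 ⊢
  exact norm_leftLim_sub_le h0 h4 h5 hw fun t ht hts => hω t ht (hts.le.trans hs)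

/-- The defect `γ - γ†` of one particle is driven by the defects of the means of all others, so the
estimate is iterated for all `u` simultaneously. The initial defect is zero, hence so is the
limiting bound. -/
theorem ae_isHermitian [IsProbabilityMeasure P] (h : IsJumpGraphonSolution P ℱ N T H L a W ρ₀ γ)
    (hW : IsGraphon W) (hN : ∀ u, IsUnitPoissonProcess P ℱ (N u)) (hT : 0 < T)
    (hL : L ∈ Matrix.unitaryGroup (Fin d) ℂ) (hH : H.IsHermitian) (ha : IsPairInteraction a)
    (hρ : ρ₀.IsHermitian) (u : I) :
    ∀ᵐ ω ∂P, ∀ t, 0 ≤ t → t ≤ T → (γ u t ω).IsHermitian := by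
  obtain ⟨B, hB0, hB⟩ := h.exists_norm_le hW hN hT hL
  -- The two terms of `norm_commutator_sub_le`: `2‖K‖` times the defect of the state, and `2‖x‖`
  -- times the defect of the Hamiltonian, itself at most `‖a‖` times that of the means. The exponent
  -- `2q + 1` makes `q / (2q + 1) ≤ 1/2`.
  set q := 2 * (‖H‖ + ‖a‖ * B) + 2 * ‖a‖ * B with hq
  have hq0 : 0 ≤ q := by positivity
  have hl : 0 < 2 * q + 1 := by positivity
  have key := iterate_contraction (F := 0) (c := 2 * B)
    (p := fun c => ∀ u, ∀ᵐ ω ∂P, ∀ t, 0 ≤ t → t ≤ T →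
      ‖γ u t ω - (γ u t ω)ᴴ‖ ≤ c * Real.exp ((2 * q + 1) * t)) le_rfl (by positivity) ?_ ?_
  -- Countably many improvements share a null set, so the limit can be taken path by path.
  · filter_upwards [ae_all_iff.2 fun k => key k u] with ω hω t h0 ht
    have h1 := le_of_forall_le_add_div_pow fun k => hω k t h0 ht
    rw [mul_zero, zero_mul] at h1
    exact (sub_eq_zero.1 (norm_le_zero_iff.1 h1)).symm
  · intro u
    filter_upwards [hB u] with ω hω t h0 ht
    refine (norm_sub_le _ _).trans ?_
    rw [Matrix.frobenius_norm_conjTranspose]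
    have h1 := hω t h0 ht
    have h2 : 2 * B ≤ 2 * B * Real.exp ((2 * q + 1) * t) :=
      le_mul_of_one_le_right (by positivity) (Real.one_le_exp (by positivity))
    linarith
  · intro c hc hp u
    have hK : ∀ᵐ s ∂volume.restrict (Ioc 0 T),
        ‖effectiveHamiltonian P H a W γ s u - (effectiveHamiltonian P H a W γ s u)ᴴ‖
          ≤ ‖a‖ * (c * Real.exp ((2 * q + 1) * s)) := by
      filter_upwards [h.ae_integrable_leftMean, ae_restrict_mem measurableSet_Ioc] with s hm hs
      rw [effectiveHamiltonian_sub_conjTranspose hH ha hW hm]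
      have h1 := norm_integral_le_of_norm_le_const (μ := (volume : Measure I))
        (f := fun v => W u v • partialInteraction a (leftMean P γ s v - (leftMean P γ s v)ᴴ))
        (C := ‖a‖ * (c * Real.exp ((2 * q + 1) * s))) (Eventually.of_forall fun v => ?_)
      · simpa using h1
      · refine (norm_smul_partialInteraction_le (hW.abs_le_one u v) _).trans ?_
        gcongr
        exact h.norm_leftMean_sub_conjTranspose_le
          (w := fun s => c * Real.exp ((2 * q + 1) * s)) (hp v) (by fun_prop) hs.1 hs.2
    filter_upwards [h.isJumpPath hW hN hT u, hp u, h.ae_norm_leftLim_le (hB u)]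
      with ω hω hpω hBω t h0 ht
    have hpath := hω.1.map conjTransposeCLM fun A => by
      simp [Matrix.conjTranspose_mul, Matrix.mul_assoc]
    have hD := hω.1.sub hpath fun A B => by rw [Matrix.mul_sub, Matrix.sub_mul]
    have h1 := hD.norm_le_add_integral (frobenius_norm_unitary_conj hL) h0 ht
    have h00 : γ u 0 ω - conjTransposeCLM (γ u 0 ω) = 0 := by
      rw [hω.2, conjTransposeCLM_apply, hρ.eq, sub_self]
    rw [h00, norm_zero, zero_add] at h1
    rw [zero_add]
    refine h1.trans ?_
    have h2 := integral_mono_ae (hD.integrableOn_Ioc le_rfl ht).norm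
      (((integrableOn_exp (2 * q + 1) 0 t)).const_mul (q * c)) ?_
    · refine h2.trans ?_
      rw [integral_const_mul]
      have h3 := setIntegral_exp_le hl h0
      calc q * c * ∫ s in Ioc 0 t, Real.exp ((2 * q + 1) * s)
          ≤ q * c * (Real.exp ((2 * q + 1) * t) / (2 * q + 1)) := by gcongr
        _ = (q / (2 * q + 1)) * (c * Real.exp ((2 * q + 1) * t)) := by ring
        _ ≤ (1 / 2) * (c * Real.exp ((2 * q + 1) * t)) := by
            refine mul_le_mul_of_nonneg_right ?_ (by positivity)
            rw [div_le_div_iff₀ hl two_pos]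
            linarith
        _ = c / 2 * Real.exp ((2 * q + 1) * t) := by ring
    · filter_upwards [ae_restrict_mem measurableSet_Ioc,
        ae_restrict_of_ae_restrict_of_subset (Ioc_subset_Ioc_right ht) hK,
        ae_restrict_of_ae_restrict_of_subset (Ioc_subset_Ioc_right ht)
          (h.ae_norm_effectiveHamiltonian_le_of_norm_le hW hB)] with s hs hKs hks
      have hsT := hs.2.trans ht
      set K := effectiveHamiltonian P H a W γ s u
      set x := Function.leftLim (fun r => γ u r ω) s with hx
      have h3 : ‖x - xᴴ‖ ≤ c * Real.exp ((2 * q + 1) * s) := by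
        have h4 := norm_leftLim_sub_le (w := fun s => c * Real.exp ((2 * q + 1) * s)) hs.1
          (hω.1.tendsto_left s hs.1 hsT) (hpath.tendsto_left s hs.1 hsT) (by fun_prop)
          fun r hr hrs => hpω r hr (hrs.le.trans hsT)
        rwa [hω.1.leftLim_map conjTransposeCLM hs.1 hsT] at h4
      -- The adjoint path obeys the same equation with `K†` in place of `K`.
      have h5 : conjTransposeCLM (commutatorDrift (fun s => effectiveHamiltonian P H a W γ s u)
          (fun t => γ u t ω) s) = (-Complex.I) • (Kᴴ * xᴴ - xᴴ * Kᴴ) := by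
        change ((-Complex.I) • (K * x - x * K))ᴴ = _
        rw [Matrix.conjTranspose_smul, Matrix.conjTranspose_sub, Matrix.conjTranspose_mul,
          Matrix.conjTranspose_mul, ← neg_sub (Kᴴ * xᴴ), smul_neg, ← neg_smul]
        simp
      rw [h5]
      refine (norm_commutator_sub_le K Kᴴ x xᴴ).trans ?_
      rw [Matrix.frobenius_norm_conjTranspose]
      have hxB : ‖x‖ ≤ B := hBω s hs.1 hsT
      have e0 : 0 ≤ c * Real.exp ((2 * q + 1) * s) := by positivity
      calc 2 * ‖K‖ * ‖x - xᴴ‖ + 2 * ‖K - Kᴴ‖ * ‖x‖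
          ≤ 2 * (‖H‖ + ‖a‖ * B) * (c * Real.exp ((2 * q + 1) * s))
            + 2 * (‖a‖ * (c * Real.exp ((2 * q + 1) * s))) * B := by
              gcongr
              exact hks u
        _ = q * c * Real.exp ((2 * q + 1) * s) := by rw [hq]; ring

theorem ae_norm_eq [IsProbabilityMeasure P] (h : IsJumpGraphonSolution P ℱ N T H L a W ρ₀ γ)
    (hW : IsGraphon W) (hN : ∀ u, IsUnitPoissonProcess P ℱ (N u)) (hT : 0 < T)
    (hL : L ∈ Matrix.unitaryGroup (Fin d) ℂ) (hH : H.IsHermitian) (ha : IsPairInteraction a)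
    (hρ : ρ₀.IsHermitian) (u : I) :
    ∀ᵐ ω ∂P, ∀ t, 0 ≤ t → t ≤ T → ‖γ u t ω‖ = ‖ρ₀‖ := by
  obtain ⟨B, hB0, hB⟩ := h.exists_norm_le hW hN hT hL
  have hK : ∀ᵐ s ∂volume.restrict (Ioc 0 T), (effectiveHamiltonian P H a W γ s u).IsHermitian := by
    filter_upwards [h.ae_integrable_leftMean, ae_restrict_mem measurableSet_Ioc] with s hm hs
    have h1 : ∀ v, leftMean P γ s v - (leftMean P γ s v)ᴴ = 0 := fun v => by
      refine norm_le_zero_iff.1 (h.norm_leftMean_sub_conjTranspose_le (w := fun _ => 0) ?_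
        continuousAt_const hs.1 hs.2)
      filter_upwards [h.ae_isHermitian hW hN hT hL hH ha hρ v] with ω hω t h0 ht
      rw [(hω t h0 ht).eq, sub_self, norm_zero]
    have h2 := effectiveHamiltonian_sub_conjTranspose hH ha hW hm u
    simp only [h1, ← partialInteractionCLM_apply, map_zero, smul_zero, integral_zero] at h2
    exact (sub_eq_zero.1 h2).symm
  filter_upwards [h.isJumpPath hW hN hT u, h.ae_norm_leftLim_le (hB u)] with ω hω hBω t h0 ht
  let _ := frobeniusInnerProductSpace (d := d)
  rw [← hω.2]
  refine hω.1.norm_eq_of_inner_eq_zero (frobenius_norm_unitary_conj hL)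
    (k := 2 * (‖H‖ + ‖a‖ * B) * B) (by positivity) ?_ ?_ h0 ht
  · filter_upwards [h.ae_norm_effectiveHamiltonian_le_of_norm_le hW hB,
      ae_restrict_mem measurableSet_Ioc] with s hs hsT
    refine (norm_commutatorDrift_le _ _ s).trans ?_
    gcongr
    · exact hs u
    · exact hBω s hsT.1 hsT.2
  · filter_upwards [hK] with s hs
    exact inner_commutator_eq_zero hs _

end IsJumpGraphonSolution

end Hermitian

/-! ### The distance of two solutions -/

section Stability

open Matrix

attribute [local instance] Matrix.frobeniusNormedSpace
attribute [local instance] frobeniusTopology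

variable {d : ℕ} {a : Matrix (Fin d × Fin d) (Fin d × Fin d) ℂ} {W₁ W₂ : I → I → ℝ}
  {Ω : Type*} [MeasurableSpace Ω] {P : Measure Ω}
  {ℱ : Filtration ℝ (inferInstance : MeasurableSpace Ω)} {N : I → ℝ → Ω → ℕ} {T : ℝ}
  {H L : Matrix (Fin d) (Fin d) ℂ} {ρ₀ : Matrix (Fin d) (Fin d) ℂ}
  {γ₁ γ₂ : I → ℝ → Ω → Matrix (Fin d) (Fin d) ℂ}

/-- The exponential factor of the pathwise stability estimate. -/
noncomputable def pathFactor (T h a : ℝ) : ℝ := 4 * Real.exp ((4 * (h + a) + 1) * T)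

theorem pathFactor_pos (T h a : ℝ) : 0 < pathFactor T h a := by
  unfold pathFactor
  positivity

namespace IsJumpGraphonSolution

/-- The randomness is gone from the right side. The factor four in `pathFactor` is two from
`IsJumpPath.gronwall` times two from the commutator with `K₁ - K₂`. -/
theorem ae_norm_sub_le [IsProbabilityMeasure P]
    (h₁ : IsJumpGraphonSolution P ℱ N T H L a W₁ ρ₀ γ₁)
    (h₂ : IsJumpGraphonSolution P ℱ N T H L a W₂ ρ₀ γ₂) (hW₁ : IsGraphon W₁) (hW₂ : IsGraphon W₂)
    (hN : ∀ u, IsUnitPoissonProcess P ℱ (N u)) (hT : 0 < T)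
    (hL : L ∈ Matrix.unitaryGroup (Fin d) ℂ)
    (hB₁ : ∀ u, ∀ᵐ ω ∂P, ∀ t, 0 ≤ t → t ≤ T → ‖γ₁ u t ω‖ ≤ 1)
    (hB₂ : ∀ u, ∀ᵐ ω ∂P, ∀ t, 0 ≤ t → t ≤ T → ‖γ₂ u t ω‖ ≤ 1) (u : I) :
    ∀ᵐ ω ∂P, ∀ t, 0 ≤ t → t ≤ T → ‖γ₁ u t ω - γ₂ u t ω‖ₑ ≤
      ENNReal.ofReal (pathFactor T ‖H‖ ‖a‖) * ∫⁻ s in Ioc 0 t,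
        ‖effectiveHamiltonian P H a W₁ γ₁ s u - effectiveHamiltonian P H a W₂ γ₂ s u‖ₑ := by
  set k := ‖H‖ + ‖a‖ with hk
  have hk0 : 0 ≤ k := by positivity
  have hl : 0 < 4 * k + 1 := by positivity
  have hK := (h₁.integrableOn_effectiveHamiltonian hW₁ u).sub
    (h₂.integrableOn_effectiveHamiltonian hW₂ u)
  filter_upwards [h₁.isJumpPath hW₁ hN hT u, h₂.isJumpPath hW₂ hN hT u,
    h₂.ae_norm_leftLim_le (hB₂ u)] with ω hω₁ hω₂ hBω t h0 ht
  have hD := hω₁.1.sub hω₂.1 fun A B => by rw [Matrix.mul_sub, Matrix.sub_mul]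
  have h1 := hD.gronwall (frobenius_norm_unitary_conj hL) (κ := fun _ => 2 * k)
    (b := fun s => 2 * ‖effectiveHamiltonian P H a W₁ γ₁ s u
      - effectiveHamiltonian P H a W₂ γ₂ s u‖) (l := 4 * k + 1)
    (integrableOn_const (by simp)) (hK.norm.const_mul 2) (fun _ => by positivity)
    (fun _ => by positivity) hl.le (fun t h0 ht => ?_) ?_ h0 ht
  · rw [hω₁.2, hω₂.2, sub_self, norm_zero, zero_add, integral_const_mul] at h1
    have hKt : IntegrableOn (fun s => effectiveHamiltonian P H a W₁ γ₁ s u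
      - effectiveHamiltonian P H a W₂ γ₂ s u) (Ioc 0 t) :=
        hK.mono_set (Ioc_subset_Ioc_right ht)
    rw [← ofReal_integral_norm_eq_lintegral_enorm hKt, ← ENNReal.ofReal_mul
      (pathFactor_pos _ _ _).le, ← ofReal_norm]
    refine ENNReal.ofReal_le_ofReal (h1.trans ?_)
    set R := ∫ s in Ioc 0 t, ‖effectiveHamiltonian P H a W₁ γ₁ s u
      - effectiveHamiltonian P H a W₂ γ₂ s u‖
    have hR : 0 ≤ R := integral_nonneg fun _ => norm_nonneg _
    calc 2 * (2 * R) * Real.exp ((4 * k + 1) * t)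
        ≤ 2 * (2 * R) * Real.exp ((4 * k + 1) * T) := by gcongr
      _ = pathFactor T ‖H‖ ‖a‖ * R := by rw [pathFactor, ← hk]; ring
  · rw [integral_const_mul]
    have h2 := setIntegral_exp_le hl h0
    calc 2 * k * ∫ s in Ioc 0 t, Real.exp ((4 * k + 1) * s)
        ≤ 2 * k * (Real.exp ((4 * k + 1) * t) / (4 * k + 1)) := by gcongr
      _ = (2 * k / (4 * k + 1)) * Real.exp ((4 * k + 1) * t) := by ring
      _ ≤ (1 / 2) * Real.exp ((4 * k + 1) * t) := by
          refine mul_le_mul_of_nonneg_right ?_ (by positivity)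
          rw [div_le_div_iff₀ hl two_pos]
          linarith
      _ = Real.exp ((4 * k + 1) * t) / 2 := by ring
  · filter_upwards [h₁.ae_norm_effectiveHamiltonian_le_of_norm_le hW₁ hB₁,
      ae_restrict_mem measurableSet_Ioc] with s hs hsT
    rw [hω₁.1.leftLim_sub hω₂.1 hsT.1 hsT.2]
    refine (norm_commutator_sub_le _ _ _ _).trans ?_
    have h3 := hs u
    have h4 := hBω s hsT.1 hsT.2
    rw [mul_one] at h3
    refine add_le_add (by gcongr) (mul_le_of_le_one_right (by positivity) h4)

/-- A deterministic almost sure bound survives left limits and expectation; this feeds the pathwise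
estimate back into the mean field. -/
theorem enorm_leftMean_sub_le [IsProbabilityMeasure P]
    (h₁ : IsJumpGraphonSolution P ℱ N T H L a W₁ ρ₀ γ₁)
    (h₂ : IsJumpGraphonSolution P ℱ N T H L a W₂ ρ₀ γ₂) {v : I} {s : ℝ} (h0 : 0 < s) (hs : s ≤ T)
    {r : ℝ≥0∞} (hr : ∀ᵐ ω ∂P, ∀ t, 0 ≤ t → t ≤ s → ‖γ₁ v t ω - γ₂ v t ω‖ₑ ≤ r) :
    ‖leftMean P γ₁ s v - leftMean P γ₂ s v‖ₑ ≤ r := by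
  rcases eq_or_ne r ∞ with rfl | hrt
  · exact le_top
  rw [h₁.leftMean_eq h0 hs, h₂.leftMean_eq h0 hs,
    ← integral_sub (h₁.integrable_leftLim h0 hs v) (h₂.integrable_leftLim h0 hs v)]
  rw [← ofReal_norm]
  refine ENNReal.ofReal_le_of_le_toReal ?_
  suffices H : ∀ᵐ ω ∂P, ‖Function.leftLim (fun r => γ₁ v r ω) s
      - Function.leftLim (fun r => γ₂ v r ω) s‖ ≤ r.toReal by
    simpa using norm_integral_le_of_norm_le_const H
  filter_upwards [h₁.cadlag v, h₂.cadlag v, hr] with ω hc₁ hc₂ hω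
  refine norm_leftLim_sub_le (w := fun _ => r.toReal) h0 (hc₁.tendsto_leftLim h0 hs)
    (hc₂.tendsto_leftLim h0 hs) continuousAt_const fun t ht hts => ?_
  rw [← toReal_enorm]
  exact ENNReal.toReal_mono hrt (hω t ht hts.le)

/-- The change of the Hamiltonian splits into the change of the means and of the graphon. -/
theorem ae_enorm_effectiveHamiltonian_sub_le
    (h₁ : IsJumpGraphonSolution P ℱ N T H L a W₁ ρ₀ γ₁)
    (h₂ : IsJumpGraphonSolution P ℱ N T H L a W₂ ρ₀ γ₂) (hW₁ : IsGraphon W₁)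
    (hW₂ : IsGraphon W₂) : ∀ᵐ s ∂volume.restrict (Ioc 0 T), ∀ u,
      ‖effectiveHamiltonian P H a W₁ γ₁ s u - effectiveHamiltonian P H a W₂ γ₂ s u‖ₑ ≤
        ‖a‖ₑ * (∫⁻ v, ‖leftMean P γ₁ s v - leftMean P γ₂ s v‖ₑ)
          + ‖∫ v, (W₁ u v - W₂ u v) • partialInteraction a (leftMean P γ₂ s v)‖ₑ := by
  filter_upwards [h₁.ae_integrable_leftMean, h₂.ae_integrable_leftMean] with s hm₁ hm₂ u
  have hWm := (hW₁.measurable_right u).sub (hW₂.measurable_right u)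
  have hWb : ∀ v, |W₁ u v - W₂ u v| ≤ 1 := fun v => abs_le.2
    ⟨by linarith [hW₁.nonneg u v, hW₂.le_one u v], by linarith [hW₂.nonneg u v, hW₁.le_one u v]⟩
  have i1 := integrable_smul_partialInteraction (a := a) (hW₁.measurable_right u)
    (hW₁.abs_le_one u) (hm₁.sub hm₂)
  have i2 := integrable_smul_partialInteraction (a := a) hWm hWb hm₂
  have j1 := integrable_smul_partialInteraction (a := a) (hW₁.measurable_right u)
    (hW₁.abs_le_one u) hm₁
  have j2 := integrable_smul_partialInteraction (a := a) (hW₂.measurable_right u)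
    (hW₂.abs_le_one u) hm₂
  have e : effectiveHamiltonian P H a W₁ γ₁ s u - effectiveHamiltonian P H a W₂ γ₂ s u
      = (∫ v, W₁ u v • partialInteraction a (leftMean P γ₁ s v - leftMean P γ₂ s v))
        + ∫ v, (W₁ u v - W₂ u v) • partialInteraction a (leftMean P γ₂ s v) := by
    rw [effectiveHamiltonian_eq hW₁ hm₁, effectiveHamiltonian_eq hW₂ hm₂,
      add_sub_add_left_eq_sub, ← integral_sub j1 j2]
    refine Eq.trans ?_ (integral_add i1 i2)
    refine integral_congr_ae (Eventually.of_forall fun v => ?_)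
    simp only [← partialInteractionCLM_apply, map_sub]
    module
  rw [e]
  refine (enorm_add_le _ _).trans (add_le_add ?_ le_rfl)
  refine (enorm_integral_le_lintegral_enorm _).trans ?_
  rw [← lintegral_const_mul' _ _ enorm_ne_top]
  refine lintegral_mono fun v => ?_
  rw [← ofReal_norm, ← ofReal_norm, ← ofReal_norm, ← ENNReal.ofReal_mul (norm_nonneg _)]
  exact ENNReal.ofReal_le_ofReal (norm_smul_partialInteraction_le (hW₁.abs_le_one u v) _)

end IsJumpGraphonSolution

theorem enorm_frobenius_le_sum (A : Matrix (Fin d) (Fin d) ℂ) : ‖A‖ₑ ≤ ∑ i, ∑ j, ‖A i j‖ₑ := by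
  simp only [← ofReal_norm]
  refine (ENNReal.ofReal_le_ofReal (frobenius_norm_le_sum A)).trans (le_of_eq ?_)
  refine (ENNReal.ofReal_sum_of_nonneg fun i _ => Finset.sum_nonneg fun j _ =>
    norm_nonneg _).trans ?_
  exact Finset.sum_congr rfl fun i _ => ENNReal.ofReal_sum_of_nonneg fun j _ => norm_nonneg _

/-- The cut norm controls the change of the mean field. -/
theorem lintegral_enorm_meanField_le {K : I → I → ℝ} (hK : Measurable fun p : I × I => K p.1 p.2)
    (hK1 : ∀ u v, |K u v| ≤ 1) {m : I → Matrix (Fin d) (Fin d) ℂ} (hm : StronglyMeasurable m)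
    (hm1 : ∀ᵐ v, ‖m v‖ ≤ 1) :
    ∫⁻ u, ‖∫ v, K u v • partialInteraction a (m v)‖ₑ
      ≤ ENNReal.ofReal (d ^ 2 * (8 * ‖a‖ * cutNorm K)) := by
  have hAm : StronglyMeasurable fun v => partialInteraction a (m v) :=
    (partialInteractionCLM a).continuous.comp_stronglyMeasurable hm
  have hentry : ∀ i j, Measurable fun v => partialInteraction a (m v) i j := fun i j =>
    ((entryCLM i j).continuous.comp_stronglyMeasurable hAm).measurable
  have hmi : Integrable m := Integrable.of_bound hm.aestronglyMeasurable 1 hm1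
  have hint : ∀ u, Integrable fun v => K u v • partialInteraction a (m v) := fun u =>
    integrable_smul_partialInteraction (hK.comp measurable_prodMk_left) (hK1 u) hmi
  have hb : ∀ i j, ∀ᵐ v, ‖partialInteraction a (m v) i j‖ ≤ ‖a‖ := fun i j => by
    filter_upwards [hm1] with v hv
    refine (norm_entry_le_frobenius _ i j).trans ((norm_partialInteraction_le a _).trans ?_)
    exact mul_le_of_le_one_right (norm_nonneg _) hv
  have hle : ∀ u, ‖∫ v, K u v • partialInteraction a (m v)‖ₑ
      ≤ ∑ i, ∑ j, ‖∫ v, K u v • partialInteraction a (m v) i j‖ₑ := fun u => by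
    have e : ∀ i j, (∫ v, K u v • partialInteraction a (m v)) i j
        = ∫ v, K u v • partialInteraction a (m v) i j := fun i j =>
      ((entryCLM i j).integral_comp_comm (hint u)).symm
    simpa only [e] using enorm_frobenius_le_sum (∫ v, K u v • partialInteraction a (m v))
  have hmeas : ∀ i j, Measurable fun u => ‖∫ v, K u v • partialInteraction a (m v) i j‖ₑ :=
    fun i j => (StronglyMeasurable.integral_prod_right'
      (f := fun p : I × I => K p.1 p.2 • partialInteraction a (m p.2) i j)
      (hK.smul ((hentry i j).comp measurable_snd)).stronglyMeasurable).measurable.enorm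
  calc ∫⁻ u, ‖∫ v, K u v • partialInteraction a (m v)‖ₑ
      ≤ ∫⁻ u, ∑ i, ∑ j, ‖∫ v, K u v • partialInteraction a (m v) i j‖ₑ := lintegral_mono hle
    _ = ∑ i, ∑ j, ∫⁻ u, ‖∫ v, K u v • partialInteraction a (m v) i j‖ₑ := by
        rw [lintegral_finsetSum _ fun i _ => Finset.measurable_sum _ fun j _ => hmeas i j]
        exact Finset.sum_congr rfl fun i _ => lintegral_finsetSum _ fun j _ => hmeas i j
    -- The cut norm estimate is scalar; applying it to each entry produces the factor `d ^ 2`.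
    _ ≤ ∑ i : Fin d, ∑ j : Fin d, ENNReal.ofReal (8 * ‖a‖ * cutNorm K) :=
        Finset.sum_le_sum fun i _ => Finset.sum_le_sum fun j _ =>
          lintegral_enorm_kernel_le hK hK1 (hentry i j) (norm_nonneg _) (hb i j)
    _ = ENNReal.ofReal (d ^ 2 * (8 * ‖a‖ * cutNorm K)) := by
        have h0 := mul_nonneg (mul_nonneg (by norm_num : (0 : ℝ) ≤ 8) (norm_nonneg a))
          (cutNorm_nonneg K)
        rw [ENNReal.ofReal_mul (p := (d : ℝ) ^ 2) (by positivity), ENNReal.ofReal_pow (by positivity)]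
        simp only [Finset.sum_const, Finset.card_univ, Fintype.card_fin, nsmul_eq_mul,
          ENNReal.ofReal_natCast]
        ring

/-- Grönwall's inequality for an extended nonnegative function. -/
theorem le_of_le_lintegral {T : ℝ} {φ : ℝ → ℝ≥0∞} {c q F : ℝ} (hc : 0 ≤ c) (hq : 0 ≤ q)
    (hF : 0 ≤ F) (hφ : ∀ t, 0 < t → t ≤ T → φ t ≤ ENNReal.ofReal c)
    (h : ∀ t, 0 < t → t ≤ T →
      φ t ≤ ENNReal.ofReal q * (∫⁻ s in Ioc 0 t, φ s) + ENNReal.ofReal F) :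
    ∀ t, 0 < t → t ≤ T → φ t ≤ ENNReal.ofReal (2 * F * Real.exp ((2 * q + 1) * t)) := by
  intro t h0 ht
  have hl : 0 < 2 * q + 1 := by positivity
  have hexp : ∀ s, 0 < s → 1 ≤ Real.exp ((2 * q + 1) * s) := fun s hs =>
    Real.one_le_exp (by positivity)
  have key := iterate_contraction (F := F) (c := c) (p := fun c => ∀ t, 0 < t → t ≤ T →
    φ t ≤ ENNReal.ofReal (c * Real.exp ((2 * q + 1) * t))) hF hc
    (fun t h0 ht => (hφ t h0 ht).trans
      (ENNReal.ofReal_le_ofReal (le_mul_of_one_le_right hc (hexp t h0))))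
    (fun c hc hp t h0 ht => ?_)
  · exact ge_of_tendsto' (ENNReal.tendsto_ofReal (tendsto_add_div_pow_mul _ _ _))
      fun k => key k t h0 ht
  -- Only monotonicity of the lower integral is used, so `φ` need not be measurable.
  · have h1 : ∫⁻ s in Ioc 0 t, φ s
        ≤ ENNReal.ofReal (c * (Real.exp ((2 * q + 1) * t) / (2 * q + 1))) := by
      calc ∫⁻ s in Ioc 0 t, φ s
          ≤ ∫⁻ s in Ioc 0 t, ENNReal.ofReal (c * Real.exp ((2 * q + 1) * s)) :=
            setLIntegral_mono' measurableSet_Ioc fun s hs => hp s hs.1 (hs.2.trans ht)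
        _ = ENNReal.ofReal (∫ s in Ioc 0 t, c * Real.exp ((2 * q + 1) * s)) :=
            (ofReal_integral_eq_lintegral_ofReal ((integrableOn_exp _ _ _).const_mul c)
              (Eventually.of_forall fun s => by positivity)).symm
        _ ≤ _ := by
            refine ENNReal.ofReal_le_ofReal ?_
            rw [integral_const_mul]
            gcongr
            exact setIntegral_exp_le hl h0.le
    refine (h t h0 ht).trans ((add_le_add (mul_le_mul_right h1 _) le_rfl).trans ?_)
    rw [← ENNReal.ofReal_mul hq, ← ENNReal.ofReal_add (by positivity) hF]
    refine ENNReal.ofReal_le_ofReal ?_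
    have h2 : q / (2 * q + 1) ≤ 1 / 2 := by
      rw [div_le_div_iff₀ hl two_pos]
      linarith
    have h3 := mul_le_mul_of_nonneg_right h2
      (mul_nonneg hc (Real.exp_pos ((2 * q + 1) * t)).le)
    have h4 := le_mul_of_one_le_right hF (hexp t h0)
    calc q * (c * (Real.exp ((2 * q + 1) * t) / (2 * q + 1))) + F
        = q / (2 * q + 1) * (c * Real.exp ((2 * q + 1) * t)) + F := by ring
      _ ≤ 1 / 2 * (c * Real.exp ((2 * q + 1) * t)) + F * Real.exp ((2 * q + 1) * t) :=
          add_le_add h3 h4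
      _ = (F + c / 2) * Real.exp ((2 * q + 1) * t) := by ring

end Stability

/-! ### The stability theorem -/

/-- The stability constant in terms of `T`, `‖H‖`, `‖a‖` and `‖L‖`. -/
noncomputable def stabilityConstant (T h a l : ℝ) : ℝ :=
  2 * (pathFactor T h a * a * (T * (2 * Real.exp ((2 * (pathFactor T h a * a) + 1) * T))) + 1)
    * (pathFactor T h a * (T * ((l ^ 2) ^ 2 * (8 * a))))

section Majorant

attribute [local instance] Matrix.frobeniusNormedSpace
attribute [local instance] frobeniusTopology

variable {d : ℕ} {a : Matrix (Fin d × Fin d) (Fin d × Fin d) ℂ} {W₁ W₂ : I → I → ℝ}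
  {Ω : Type*} [MeasurableSpace Ω] {P : Measure Ω}
  {ℱ : Filtration ℝ (inferInstance : MeasurableSpace Ω)} {N : I → ℝ → Ω → ℕ} {T : ℝ}
  {H L : Matrix (Fin d) (Fin d) ℂ} {ρ₀ : Matrix (Fin d) (Fin d) ℂ}
  {γ₁ γ₂ : I → ℝ → Ω → Matrix (Fin d) (Fin d) ℂ}

/-- The bound is deterministic and measurable in `u` even if the solutions are not, so it serves
both conclusions of the theorem. -/
theorem IsJumpGraphonSolution.exists_measurable_majorant [IsProbabilityMeasure P]
    (h₁ : IsJumpGraphonSolution P ℱ N T H L a W₁ ρ₀ γ₁)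
    (h₂ : IsJumpGraphonSolution P ℱ N T H L a W₂ ρ₀ γ₂) (hW₁ : IsGraphon W₁) (hW₂ : IsGraphon W₂)
    (hN : ∀ u, IsUnitPoissonProcess P ℱ (N u)) (hT : 0 < T)
    (hL : L ∈ Matrix.unitaryGroup (Fin d) ℂ) (hH : H.IsHermitian) (ha : IsPairInteraction a)
    (hρ : IsDensityMatrix ρ₀) :
    ∃ X : I → ℝ≥0∞, Measurable X ∧
      (∀ u, ∀ᵐ ω ∂P, ∀ t, 0 ≤ t → t ≤ T → ‖γ₁ u t ω - γ₂ u t ω‖ₑ ^ 2 ≤ X u) ∧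
      ∫⁻ u, X u ≤ ENNReal.ofReal
        (stabilityConstant T ‖H‖ ‖a‖ ‖L‖ * cutNorm fun u v => W₁ u v - W₂ u v) := by
  have hB₁ : ∀ u, ∀ᵐ ω ∂P, ∀ t, 0 ≤ t → t ≤ T → ‖γ₁ u t ω‖ ≤ 1 := fun u =>
    (h₁.ae_norm_eq hW₁ hN hT hL hH ha hρ.1.isHermitian u).mono
      fun ω hω t h0 ht => (hω t h0 ht).trans_le hρ.norm_le_one
  have hB₂ : ∀ u, ∀ᵐ ω ∂P, ∀ t, 0 ≤ t → t ≤ T → ‖γ₂ u t ω‖ ≤ 1 := fun u =>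
    (h₂.ae_norm_eq hW₂ hN hT hL hH ha hρ.1.isHermitian u).mono
      fun ω hω t h0 ht => (hω t h0 ht).trans_le hρ.norm_le_one
  have htwo : ∀ u, ∀ᵐ ω ∂P, ∀ t, 0 ≤ t → t ≤ T → ‖γ₁ u t ω - γ₂ u t ω‖ₑ ≤ 2 := fun u => by
    filter_upwards [hB₁ u, hB₂ u] with ω h1 h2 t h0 ht
    rw [← ofReal_norm, show (2 : ℝ≥0∞) = ENNReal.ofReal 2 by simp]
    refine ENNReal.ofReal_le_ofReal ((norm_sub_le _ _).trans ?_)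
    linarith [h1 t h0 ht, h2 t h0 ht]
  set K : I → I → ℝ := fun u v => W₁ u v - W₂ u v with hKdef
  have hK : Measurable fun p : I × I => K p.1 p.2 := hW₁.measurable.sub hW₂.measurable
  have hK1 : ∀ u v, |K u v| ≤ 1 := fun u v => abs_le.2
    ⟨by simp only [hKdef]; linarith [hW₁.nonneg u v, hW₂.le_one u v],
      by simp only [hKdef]; linarith [hW₂.nonneg u v, hW₁.le_one u v]⟩
  set c₀ := pathFactor T ‖H‖ ‖a‖ with hc₀
  have hc0 : 0 < c₀ := pathFactor_pos _ _ _
  set G : ℝ := d ^ 2 * (8 * ‖a‖ * cutNorm K) with hG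
  have hG0 : 0 ≤ G := by
    have := cutNorm_nonneg K
    positivity
  -- A measurable version of the mean field of the second solution.
  obtain ⟨m, hm, hmeq⟩ : ∃ m : ℝ × I → Matrix (Fin d) (Fin d) ℂ, StronglyMeasurable m ∧
      ∀ᵐ s ∂volume.restrict (Ioc 0 T), ∀ᵐ v : I, leftMean P γ₂ s v = m (s, v) :=
    ⟨_, h₂.integrable_leftMean.aestronglyMeasurable.stronglyMeasurable_mk,
      Measure.ae_ae_of_ae_prod h₂.integrable_leftMean.aestronglyMeasurable.ae_eq_mk⟩
  set g : ℝ → I → ℝ≥0∞ := fun s u => ‖∫ v, K u v • partialInteraction a (m (s, v))‖ₑ with hg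
  have hgm : Measurable fun p : ℝ × I => g p.1 p.2 := by
    have h1 : StronglyMeasurable fun q : (ℝ × I) × I =>
        K q.1.2 q.2 • partialInteraction a (m (q.1.1, q.2)) :=
      (hK.comp ((measurable_snd.comp measurable_fst).prodMk
        measurable_snd)).stronglyMeasurable.smul
        ((partialInteractionCLM a).continuous.comp_stronglyMeasurable
          (hm.comp_measurable ((measurable_fst.comp measurable_fst).prodMk measurable_snd)))
    exact h1.integral_prod_right'.enorm
  have hgint : ∀ᵐ s ∂volume.restrict (Ioc 0 T), ∫⁻ u, g s u ≤ ENNReal.ofReal G := by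
    filter_upwards [hmeq, ae_restrict_mem measurableSet_Ioc] with s hs hsT
    refine lintegral_enorm_meanField_le hK hK1 (hm.comp_measurable measurable_prodMk_left) ?_
    filter_upwards [hs] with v hv
    rw [← hv]
    exact h₂.norm_leftMean_le (hB₂ v) hsT.1 hsT.2
  set Φ : ℝ → ℝ≥0∞ := fun s => ∫⁻ v, ‖leftMean P γ₁ s v - leftMean P γ₂ s v‖ₑ with hΦ
  -- The deterministic majorant of `‖D_t^u‖`. It is measurable in `u` because `Φ` does not involve
  -- `u` and `g` is built from the measurable version `m`.
  set Y : ℝ → I → ℝ≥0∞ := fun t u =>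
    ENNReal.ofReal c₀ * ∫⁻ s in Ioc 0 t, (‖a‖ₑ * Φ s + g s u) with hY
  have hD : ∀ u, ∀ᵐ ω ∂P, ∀ t, 0 ≤ t → t ≤ T → ‖γ₁ u t ω - γ₂ u t ω‖ₑ ≤ Y t u := by
    intro u
    filter_upwards [h₁.ae_norm_sub_le h₂ hW₁ hW₂ hN hT hL hB₁ hB₂ u] with ω hω t h0 ht
    refine (hω t h0 ht).trans (mul_le_mul_right (lintegral_mono_ae ?_) _)
    filter_upwards [ae_restrict_of_ae_restrict_of_subset (Ioc_subset_Ioc_right ht)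
        (h₁.ae_enorm_effectiveHamiltonian_sub_le h₂ hW₁ hW₂),
      ae_restrict_of_ae_restrict_of_subset (Ioc_subset_Ioc_right ht) hmeq] with s h1 h2
    refine (h1 u).trans (add_le_add le_rfl (le_of_eq ?_))
    simp only [hg]
    congr 1
    exact integral_congr_ae (h2.mono fun v hv => by simp only [hv, hKdef])
  clear_value g
  have hYmono : ∀ u s t, s ≤ t → Y s u ≤ Y t u := fun u s t hst =>
    mul_le_mul_right (lintegral_mono_set (Ioc_subset_Ioc_right hst)) _
  have hYsplit : ∀ t u, Y t u = ENNReal.ofReal c₀ * (‖a‖ₑ * (∫⁻ s in Ioc 0 t, Φ s)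
      + ∫⁻ s in Ioc 0 t, g s u) := fun t u => by
    simp only [hY]
    have hgu : Measurable fun s => g s u :=
      hgm.comp (measurable_id.prodMk measurable_const)
    rw [lintegral_add_right _ hgu, lintegral_const_mul' _ _ enorm_ne_top]
  have hgt : ∀ t, Measurable fun u => ∫⁻ s in Ioc 0 t, g s u := fun t =>
    Measurable.lintegral_prod_left' hgm
  have hYm : ∀ t, Measurable (Y t) := fun t => by
    rw [funext (hYsplit t)]
    exact ((hgt t).const_add _).const_mul _
  have hYint : ∀ t, 0 ≤ t → t ≤ T → ∫⁻ u, Y t u ≤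
      ENNReal.ofReal (c₀ * ‖a‖) * (∫⁻ s in Ioc 0 t, Φ s) + ENNReal.ofReal (c₀ * (T * G)) := by
    intro t h0 ht
    simp only [hYsplit]
    rw [lintegral_const_mul' _ _ ENNReal.ofReal_ne_top, lintegral_add_left measurable_const,
      lintegral_const, measure_univ, mul_one, mul_add, ENNReal.ofReal_mul hc0.le,
      ENNReal.ofReal_mul hc0.le, ofReal_norm, mul_assoc]
    refine add_le_add le_rfl (mul_le_mul_right ?_ _)
    rw [lintegral_lintegral_swap (f := fun u s => g s u) (hgm.comp measurable_swap).aemeasurable]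
    calc ∫⁻ s in Ioc 0 t, ∫⁻ u, g s u ≤ ∫⁻ _ in Ioc 0 t, ENNReal.ofReal G :=
          lintegral_mono_ae
            (ae_restrict_of_ae_restrict_of_subset (Ioc_subset_Ioc_right ht) hgint)
      _ ≤ ENNReal.ofReal (T * G) := by
          rw [setLIntegral_const, Real.volume_Ioc, sub_zero, ← ENNReal.ofReal_mul hG0]
          refine ENNReal.ofReal_le_ofReal ?_
          rw [mul_comm]
          gcongr
  -- The means inherit the pathwise bound; with `hYint` this closes an integral inequality for `Φ`
  -- alone.
  have hΦY : ∀ t, 0 < t → t ≤ T → Φ t ≤ ∫⁻ u, Y t u := fun t h0 ht =>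
    lintegral_mono fun v => h₁.enorm_leftMean_sub_le h₂ h0 ht <| by
      filter_upwards [hD v] with ω hω s hs hst
      exact (hω s hs (hst.trans ht)).trans (hYmono v s t hst)
  have hF0 : 0 ≤ c₀ * (T * G) := by positivity
  have hΦle := le_of_le_lintegral (T := T) (φ := Φ) (c := 2) (q := c₀ * ‖a‖) (F := c₀ * (T * G))
    two_pos.le (by positivity) hF0
    (fun t h0 ht => by
      calc Φ t ≤ ∫⁻ _ : I, 2 := lintegral_mono fun v => h₁.enorm_leftMean_sub_le h₂ h0 ht <| by
            filter_upwards [htwo v] with ω hω s hs hst using hω s hs (hst.trans ht)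
        _ = ENNReal.ofReal 2 := by simp)
    (fun t h0 ht => (hΦY t h0 ht).trans (hYint t h0.le ht))
  -- One factor of the square is bounded by two, the other by `Y T u`; this keeps the estimate
  -- linear in the cut norm.
  refine ⟨fun u => 2 * Y T u, (hYm T).const_mul _, fun u => ?_, ?_⟩
  · filter_upwards [hD u, htwo u] with ω h1 h2 t h0 ht
    rw [sq]
    exact mul_le_mul' (h2 t h0 ht) ((h1 t h0 ht).trans (hYmono u t T ht))
  · rw [lintegral_const_mul _ (hYm T)]
    set E := Real.exp ((2 * (c₀ * ‖a‖) + 1) * T) with hE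
    have hΦT : ∫⁻ s in Ioc 0 T, Φ s ≤ ENNReal.ofReal (2 * (c₀ * (T * G)) * E * T) := by
      calc ∫⁻ s in Ioc 0 T, Φ s
          ≤ ∫⁻ _ in Ioc 0 T, ENNReal.ofReal (2 * (c₀ * (T * G)) * E) :=
            setLIntegral_mono' measurableSet_Ioc fun s hs =>
              (hΦle s hs.1 hs.2).trans (ENNReal.ofReal_le_ofReal (by
                rw [hE]
                gcongr
                exact hs.2))
        _ = ENNReal.ofReal (2 * (c₀ * (T * G)) * E * T) := by
            rw [setLIntegral_const, Real.volume_Ioc, sub_zero,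
              ← ENNReal.ofReal_mul (by positivity)]
    calc 2 * ∫⁻ u, Y T u
        ≤ 2 * (ENNReal.ofReal (c₀ * ‖a‖) * ENNReal.ofReal (2 * (c₀ * (T * G)) * E * T)
            + ENNReal.ofReal (c₀ * (T * G))) := by
          refine mul_le_mul_right ((hYint T hT.le le_rfl).trans ?_) _
          gcongr
      _ = ENNReal.ofReal (2 * (c₀ * ‖a‖ * (2 * (c₀ * (T * G)) * E * T) + c₀ * (T * G))) := by
          rw [ENNReal.ofReal_mul two_pos.le, ENNReal.ofReal_add (by positivity) hF0,
            ENNReal.ofReal_mul (p := c₀ * ‖a‖) (by positivity), ENNReal.ofReal_ofNat]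
      _ = ENNReal.ofReal (stabilityConstant T ‖H‖ ‖a‖ ‖L‖ * cutNorm K) := by
          congr 1
          -- Here the factor `d ^ 2` in `G` is identified with `(‖L‖ ^ 2) ^ 2`.
          rw [stabilityConstant, frobenius_norm_sq_of_mem_unitaryGroup hL, ← hc₀, ← hE, hG]
          ring

end Majorant

theorem mainTheorem4 :
    ∃ C : ℝ → ℝ → ℝ → ℝ → ℝ≥0,
      ∀ (T : ℝ) (_ : 0 < T) (d : ℕ)
        (H L : Matrix (Fin d) (Fin d) ℂ) (a : Matrix (Fin d × Fin d) (Fin d × Fin d) ℂ)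
        (_ : H.IsHermitian) (_ : L ∈ Matrix.unitaryGroup (Fin d) ℂ) (_ : IsPairInteraction a)
        (ρ₀ : Matrix (Fin d) (Fin d) ℂ) (_ : IsDensityMatrix ρ₀)
        (W₁ W₂ : I → I → ℝ) (_ : IsGraphon W₁) (_ : IsGraphon W₂)
        (Ω : Type*) [MeasurableSpace Ω] (P : Measure Ω) [IsProbabilityMeasure P]
        (ℱ : Filtration ℝ (inferInstance : MeasurableSpace Ω)) (N : I → ℝ → Ω → ℕ)
        (_ : ∀ u, IsUnitPoissonProcess P ℱ (N u))
        (γ₁ γ₂ : I → ℝ → Ω → Matrix (Fin d) (Fin d) ℂ)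
        (_ : IsJumpGraphonSolution P ℱ N T H L a W₁ ρ₀ γ₁)
        (_ : IsJumpGraphonSolution P ℱ N T H L a W₂ ρ₀ γ₂),
        (AEMeasurable (fun p : Ω × I =>
              supSqDist T (fun t => γ₁ p.2 t p.1) (fun t => γ₂ p.2 t p.1)) (P.prod volume) →
            ∫⁻ ω, ∫⁻ u, supSqDist T (fun t => γ₁ u t ω) (fun t => γ₂ u t ω) ∂volume ∂P
              ≤ C T ‖H‖ ‖a‖ ‖L‖ * ENNReal.ofReal (cutNorm fun u v => W₁ u v - W₂ u v)) ∧
          upperIntegral (fun u =>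
              ∫⁻ ω, supSqDist T (fun t => γ₁ u t ω) (fun t => γ₂ u t ω) ∂P)
            ≤ C T ‖H‖ ‖a‖ ‖L‖ * ENNReal.ofReal (cutNorm fun u v => W₁ u v - W₂ u v) := by
  refine ⟨fun T h a l => (stabilityConstant T h a l).toNNReal, ?_⟩
  intro T hT d H L a hH hL ha ρ₀ hρ W₁ W₂ hW₁ hW₂ Ω _ P _ ℱ N hN γ₁ γ₂ h₁ h₂
  obtain ⟨X, hXm, hX, hXint⟩ :=
    h₁.exists_measurable_majorant h₂ hW₁ hW₂ hN hT hL hH ha hρ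
  have hle : ∀ u, ∫⁻ ω, supSqDist T (fun t => γ₁ u t ω) (fun t => γ₂ u t ω) ∂P ≤ X u := fun u => by
    calc ∫⁻ ω, supSqDist T (fun t => γ₁ u t ω) (fun t => γ₂ u t ω) ∂P
        ≤ ∫⁻ _, X u ∂P := lintegral_mono_ae <| (hX u).mono fun ω hω =>
          iSup₂_le fun t ht => hω t ht.1 ht.2
      _ = X u := by simp
  have hC : ENNReal.ofReal (stabilityConstant T ‖H‖ ‖a‖ ‖L‖ * cutNorm fun u v => W₁ u v - W₂ u v)
      = ((stabilityConstant T ‖H‖ ‖a‖ ‖L‖).toNNReal : ℝ≥0∞)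
        * ENNReal.ofReal (cutNorm fun u v => W₁ u v - W₂ u v) :=
    ENNReal.ofReal_mul' (cutNorm_nonneg _)
  rw [← hC]
  refine ⟨fun hm => ?_, ?_⟩
  -- Joint measurability serves only for Tonelli; afterwards the bound for each `u` is integrated.
  · rw [lintegral_lintegral_swap hm]
    exact (lintegral_mono hle).trans hXint
  · exact (iInf_le _ ⟨X, hXm, hle⟩).trans hXint
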